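/- Let $n\ge 1$. For $s>0$ let $$G_s(x)=\frac{(2\sqrt{\pi})^{-n}}{\Gamma(s/2)}\int_0^\infty e^{-t}\,e^{-|x|^2/(4t)}\,t^{\frac{s-n}{2}}\,\frac{dt}{t},\qquad x\in\mathbb{R}^n,$$ be the Bessel potential, the convolution kernel of $(I-\Delta)^{-s/2}$. For $1<p<\infty$ let $$H^{s,p}(\mathbb{R}^n)=\{u : u=G_s*f \text{ a.e. for some } f\in L^p(\mathbb{R}^n)\},\qquad \|u\|_{H^{s,p}(\mathbb{R}^n)}=\inf\{\|f\|_{L^p(\mathbb{R}^n)} : f\in L^p(\mathbb{R}^n),\ u=G_s*f\text{ a.e.}\}$$ (the function $f$ is in fact unique, so that $\|u\|_{H^{s,p}}=\|f\|_{L^p}$), and let $H^{s,p}_{rad}(\mathbb{R}^n)$ be the subspace of radial functions, i.e. those with $u(x)=u_0(|x|)$ for almost every $x$ and some function $u_0$. **Theorem (critical weighted embedding for radial functions).** Let $1<p<\infty$, $0<s<n/p$, and let $c>-n$ be such that $(1-sp)\,c\le (n-1)\,ps$. Put $p^*_c=\dfrac{p(n+c)}{n-sp}$ and assume that $p\le p^*_c$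 (equivalently, $c\ge -sp$). Then there is a constant $C>0$, depending only on $n,p,s,c$, such that $$\big\| |x|^{c/p^*_c}\,u\big\|_{L^{p^*_c}(\mathbb{R}^n)}\le C\,\|u\|_{H^{s,p}(\mathbb{R}^n)}\qquad\text{for every } u\in H^{s,p}_{rad}(\mathbb{R}^n).$$ -/

import Mathlib

open MeasureTheory
open scoped ENNReal

noncomputable section

/-- The Bessel potential `G_s` on `ℝⁿ`, the convolution kernel of `(I - Δ)^{-s/2}`:
`G_s(x) = (2√π)^{-n} / Γ(s/2) * ∫₀^∞ e^{-t} e^{-|x|²/(4t)} t^{(s-n)/2} dt/t`. -/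
def besselKernel (n : ℕ) (s : ℝ) (x : EuclideanSpace ℝ (Fin n)) : ℝ :=
  ((2 * Real.sqrt Real.pi) ^ n)⁻¹ / Real.Gamma (s / 2) *
    ∫ t in Set.Ioi (0 : ℝ),
      Real.exp (-t) * Real.exp (-‖x‖ ^ 2 / (4 * t)) * t ^ ((s - n) / 2) / t

/-- The Bessel potential operator `(I - Δ)^{-s/2} f = G_s * f`. -/
def besselPotentialOp {𝕜 : Type*} [RCLike 𝕜] (n : ℕ) (s : ℝ)
    (f : EuclideanSpace ℝ (Fin n) → 𝕜) : EuclideanSpace ℝ (Fin n) → 𝕜 :=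
  fun x => ∫ y, (besselKernel n s (x - y) : 𝕜) * f y

/-- `f ∈ L^p(ℝⁿ)` represents `u` as a potential: `u = (I - Δ)^{-s/2} f` almost everywhere. -/
def IsPotentialOf {𝕜 : Type*} [RCLike 𝕜] (n : ℕ) (s p : ℝ)
    (u f : EuclideanSpace ℝ (Fin n) → 𝕜) : Prop :=
  MemLp f (ENNReal.ofReal p) volume ∧ u =ᵐ[volume] besselPotentialOp n s f

/-- The potential space `H^{s,p}(ℝⁿ) = {u : u = (I - Δ)^{-s/2} f with f ∈ L^p(ℝⁿ)}`. -/
def MemPotentialSpace {𝕜 : Type*} [RCLike 𝕜] (n : ℕ) (s p : ℝ)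
    (u : EuclideanSpace ℝ (Fin n) → 𝕜) : Prop :=
  ∃ f, IsPotentialOf n s p u f

/-- The norm of `H^{s,p}(ℝⁿ)`: `‖u‖_{H^{s,p}} = ‖f‖_{L^p}` where `u = (I - Δ)^{-s/2} f`.
The infimum runs over all the representing `f ∈ L^p(ℝⁿ)`, which agree almost everywhere;
it is `∞` when `u` is not in the space. -/
def potentialNorm {𝕜 : Type*} [RCLike 𝕜] (n : ℕ) (s p : ℝ)
    (u : EuclideanSpace ℝ (Fin n) → 𝕜) : ℝ≥0∞ :=
  ⨅ (f : EuclideanSpace ℝ (Fin n) → 𝕜) (_ : IsPotentialOf n s p u f),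
    eLpNorm f (ENNReal.ofReal p) volume

/-- Radial symmetry (for functions determined up to null sets): `u(x) = u₀(|x|)`
for almost every `x`. -/
def IsRadial {𝕜 : Type*} {n : ℕ} (u : EuclideanSpace ℝ (Fin n) → 𝕜) : Prop :=
  ∃ u₀ : ℝ → 𝕜, ∀ᵐ x ∂(volume : Measure (EuclideanSpace ℝ (Fin n))), u x = u₀ ‖x‖

/-- The weighted critical exponent `p*_c = p (n + c) / (n - s p)`. -/
def criticalExponent (n : ℕ) (s p c : ℝ) : ℝ :=
  p * (n + c) / (n - s * p)

end

/-! Radial symmetry reduces the inequality to a convolution estimate on the line. Dropping `e^{-t}`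
from the integral defining `G_s` gives `G_s(x) ≤ C|x|^{s-n}`, so `|u|` is at most a Riesz potential
of `|f|`. Since `u` is radial, it is also at most the average of that potential over the sphere of
radius `|x|`. The representing `f` need not be radial.

Put `|x| = e^t`, `q = p*_c` and `α = n/p - s`, so that `αq = n + c`. The weighted `L^q` norm of a
radial function `V(log|x|)` is then a constant times the `L^q(ℝ)` norm of `e^{αt} V(t)`, while
`‖f‖_p` is exactly the `L^p(ℝ)` norm of `Φ(τ) = e^{nτ/p} ‖f(e^τ ·)‖_{L^p(S)}`. In these coordinates
the spherical average of the Riesz potential is dominated by the convolution of `Φ` with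
`e^{-ε|z|}|z|^{-θ}`, for any `0 < θ < 1` with `θ ≥ 1 - s` (`lintegral_sphere_rieszPotential_le`).
Averaging over the sphere absorbs `n - 1` dimensions of the singularity; the exponential decay comes
from `0 < α < n - s`.

It remains to map `L^p(ℝ)` to `L^q(ℝ)` (`exists_expRieszKernel_Lp_Lq`). For `q = p` Young's
inequality suffices. For `q > p` the one-dimensional Hardy–Littlewood–Sobolev inequality requires `θ
= 1 + 1/q - 1/p`, and then `θ ≥ 1 - s` is precisely the hypothesis `(1 - sp)c ≤ (n - 1)ps`. -/

/-! ### Power kernels, Hardy–Littlewood–Sobolev and Young inequalities on the line. -/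

theorem lintegral_le_two_mul_of_abs (g : ℝ → ℝ≥0∞) :
    ∫⁻ z : ℝ, g |z| ≤ 2 * ∫⁻ z in Set.Ioi (0 : ℝ), g z := by
  have h1 : ∫⁻ z in Set.Ioi (0 : ℝ), g |z| = ∫⁻ z in Set.Ioi (0 : ℝ), g z :=
    setLIntegral_congr_fun measurableSet_Ioi fun z hz => by rw [abs_of_pos hz]
  have h2 : ∫⁻ z in Set.Iic (0 : ℝ), g |z| = ∫⁻ z in Set.Ioi (0 : ℝ), g z := by
    rw [← setLIntegral_congr Iio_ae_eq_Iic, ← h1]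
    have := (Measure.measurePreserving_neg (volume : Measure ℝ)).setLIntegral_comp_preimage_emb
      (Homeomorph.neg ℝ).measurableEmbedding (fun z => g |z|) (Set.Ioi 0)
    simpa using this
  rw [← lintegral_add_compl (fun z => g |z|) (measurableSet_Ioi (a := (0 : ℝ))), Set.compl_Ioi,
    h1, h2, two_mul]

theorem lintegral_near_rpow_le {θ : ℝ} (hθ : θ < 1) {R : ℝ} (hR : 0 < R) :
    ∫⁻ z in {z : ℝ | |z| < R}, ‖z‖ₑ ^ (-θ) ≤ ENNReal.ofReal (2 / (1 - θ) * R ^ (1 - θ)) := by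
  have hm : MeasurableSet {z : ℝ | |z| < R} := measurableSet_lt (by fun_prop) (by fun_prop)
  rw [← lintegral_indicator hm]
  have h := lintegral_le_two_mul_of_abs
    (fun z => Set.indicator (Set.Iio R) (fun z => ENNReal.ofReal (z ^ (-θ))) z)
  have hint : IntervalIntegrable (fun x : ℝ => x ^ (-θ)) volume 0 R :=
    intervalIntegral.intervalIntegrable_rpow' (by linarith)
  have h3 : ∫⁻ z in Set.Ioi (0 : ℝ),
      Set.indicator (Set.Iio R) (fun z => ENNReal.ofReal (z ^ (-θ))) z
      = ENNReal.ofReal (R ^ (1 - θ) / (1 - θ)) := by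
    rw [setLIntegral_indicator measurableSet_Iio, Set.inter_comm, Set.Ioi_inter_Iio,
      setLIntegral_congr Ioo_ae_eq_Ioc, ← ofReal_integral_eq_lintegral_ofReal hint.1,
      ← intervalIntegral.integral_of_le hR.le, integral_rpow (Or.inl (by linarith))]
    · rw [Real.zero_rpow (by linarith)]
      congr 1
      rw [sub_zero]
      congr 1 <;> [congr 1; skip] <;> ring
    · filter_upwards [ae_restrict_mem measurableSet_Ioc] with z hz
      exact Real.rpow_nonneg hz.1.le _
  rw [h3] at h
  have h4 : (2 : ℝ≥0∞) * ENNReal.ofReal (R ^ (1 - θ) / (1 - θ))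
      = ENNReal.ofReal (2 / (1 - θ) * R ^ (1 - θ)) := by
    rw [show (2 : ℝ≥0∞) = ENNReal.ofReal 2 by simp, ← ENNReal.ofReal_mul (by norm_num)]
    congr 1; ring
  rw [h4] at h
  refine le_trans (lintegral_mono_ae ?_) h
  have h0 : ∀ᵐ z : ℝ, z ≠ 0 := by simp [ae_iff]
  filter_upwards [h0] with z hz
  by_cases hzR : |z| < R
  · simp only [Set.indicator, Set.mem_ofPred_eq, hzR, if_true, Set.mem_Iio]
    rw [Real.enorm_eq_ofReal_abs, ENNReal.ofReal_rpow_of_pos (abs_pos.2 hz)]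
  · simp [hzR]

theorem lintegral_far_rpow_le {b : ℝ} (hb : 1 < b) {R : ℝ} (hR : 0 < R) :
    ∫⁻ z in {z : ℝ | |z| < R}ᶜ, ‖z‖ₑ ^ (-b) ≤ ENNReal.ofReal (2 / (b - 1) * R ^ (1 - b)) := by
  have hm : MeasurableSet {z : ℝ | |z| < R} := measurableSet_lt (by fun_prop) (by fun_prop)
  rw [← lintegral_indicator hm.compl]
  have h := lintegral_le_two_mul_of_abs
    (fun z => Set.indicator (Set.Ici R) (fun z => ENNReal.ofReal (z ^ (-b))) z)
  have h3 : ∫⁻ z in Set.Ioi (0 : ℝ),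
      Set.indicator (Set.Ici R) (fun z => ENNReal.ofReal (z ^ (-b))) z
      = ENNReal.ofReal (R ^ (1 - b) / (b - 1)) := by
    rw [setLIntegral_indicator measurableSet_Ici, Set.inter_eq_left.2
      (Set.Ici_subset_Ioi.2 hR), setLIntegral_congr Ioi_ae_eq_Ici.symm,
      ← ofReal_integral_eq_lintegral_ofReal (integrableOn_Ioi_rpow_of_lt (by linarith) hR),
      integral_Ioi_rpow_of_lt (by linarith) hR]
    · congr 1
      rw [neg_div, ← div_neg]
      congr 1 <;> [congr 1; skip] <;> ring
    · filter_upwards [ae_restrict_mem measurableSet_Ioi] with z hz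
      exact Real.rpow_nonneg (hR.le.trans hz.le) _
  rw [h3] at h
  have h4 : (2 : ℝ≥0∞) * ENNReal.ofReal (R ^ (1 - b) / (b - 1))
      = ENNReal.ofReal (2 / (b - 1) * R ^ (1 - b)) := by
    rw [show (2 : ℝ≥0∞) = ENNReal.ofReal 2 by simp, ← ENNReal.ofReal_mul (by norm_num)]
    congr 1; ring
  rw [h4] at h
  refine le_trans (lintegral_mono fun z => ?_) h
  by_cases hzR : |z| < R
  · simp [hzR]
  · have hz : R ≤ |z| := not_lt.1 hzR
    simp only [Set.indicator, Set.mem_compl_iff, Set.mem_ofPred_eq, hzR, not_false_eq_true,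
      if_true, Set.mem_Ici, hz]
    rw [Real.enorm_eq_ofReal_abs, ENNReal.ofReal_rpow_of_pos (hR.trans_le hz)]

/-- Layer-cake representation of a power of an extended nonnegative real. -/
theorem ENNReal.rpow_eq_lintegral_lt (v : ℝ≥0∞) {r : ℝ} (hr : 0 < r) :
    v ^ r = ∫⁻ t in Set.Ioi (0 : ℝ),
      Set.indicator {t : ℝ | ENNReal.ofReal t < v} (fun t => ENNReal.ofReal (r * t ^ (r - 1))) t := by
  have key : ∀ a : ℝ, 0 ≤ a → (ENNReal.ofReal a) ^ r = ∫⁻ t in Set.Ioi (0 : ℝ),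
      Set.indicator {t : ℝ | ENNReal.ofReal t < ENNReal.ofReal a}
        (fun t => ENNReal.ofReal (r * t ^ (r - 1))) t := by
    intro a ha
    -- The layer-cake formula for a constant function under a Dirac mass is the pointwise identity.
    have := lintegral_rpow_eq_lintegral_meas_lt_mul (μ := Measure.dirac ()) (f := fun _ => a)
      (Filter.Eventually.of_forall fun _ => ha) (by fun_prop) hr
    rw [lintegral_dirac] at this
    rw [ENNReal.ofReal_rpow_of_nonneg ha hr.le, this,
      ← lintegral_const_mul' _ _ ENNReal.ofReal_ne_top]
    refine setLIntegral_congr_fun measurableSet_Ioi fun t ht => ?_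
    have ht' : 0 < t := ht
    by_cases h : t < a
    · have h' : ENNReal.ofReal t < ENNReal.ofReal a :=
        (ENNReal.ofReal_lt_ofReal_iff_of_nonneg ht'.le).2 h
      simp only [Set.indicator, Set.mem_ofPred_eq, h', if_true, h]
      rw [ENNReal.ofReal_mul hr.le]
      simp
    · have h' : ¬ ENNReal.ofReal t < ENNReal.ofReal a := fun hh => h
        ((ENNReal.ofReal_lt_ofReal_iff_of_nonneg ht'.le).1 hh)
      simp [h', h]
  by_cases hv : v = ⊤
  · subst hv
    rw [ENNReal.top_rpow_of_pos hr]
    symm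
    -- The finite case at `b^{1/r}` shows that the integral is at least `b`, for every finite `b`.
    refine ENNReal.eq_top_of_forall_nnreal_le fun b => ?_
    have hb := key ((b : ℝ) ^ (1 / r)) (by positivity)
    rw [ENNReal.ofReal_rpow_of_nonneg (by positivity) hr.le, ← Real.rpow_mul (by positivity),
      one_div_mul_cancel hr.ne', Real.rpow_one, ENNReal.ofReal_coe_nnreal] at hb
    rw [hb]
    refine lintegral_mono fun t => ?_
    refine Set.indicator_le_indicator_of_subset (fun t _ => ?_) (fun _ => zero_le) t
    exact ENNReal.ofReal_lt_top
  · have := key v.toReal ENNReal.toReal_nonneg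
    rwa [ENNReal.ofReal_toReal hv] at this

theorem lintegral_kernel_sub_mul_eq (k F : ℝ → ℝ≥0∞) (hk : Measurable k) (hF : Measurable F) :
    ∫⁻ x, ∫⁻ y, k (x - y) * F y = (∫⁻ z, k z) * ∫⁻ y, F y := by
  rw [lintegral_lintegral_swap (by fun_prop)]
  rw [← lintegral_const_mul _ hF]
  refine lintegral_congr fun y => ?_
  rw [lintegral_mul_const _ (by fun_prop), lintegral_sub_right_eq_self k y]

/-- Superlevel set estimate for the one-dimensional fractional integral. -/
theorem meas_fractionalIntegral_gt_le {p q θ : ℝ} (hp : 1 < p) (hpq : p < q)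
    (hθ : θ = 1 + 1 / q - 1 / p) :
    ∃ c : ℝ, 0 < c ∧ ∀ F : ℝ → ℝ≥0∞, Measurable F → ∫⁻ y, F y ^ p ≤ 1 → ∀ t : ℝ, 0 < t →
      ENNReal.ofReal (c * t ^ (q / p)) *
          volume {x : ℝ | ENNReal.ofReal t < ∫⁻ y, ‖x - y‖ₑ ^ (-θ) * F y}
        ≤ ∫⁻ y in {y | ENNReal.ofReal (c * t ^ (q / p)) < F y}, F y := by
  have hp0 : 0 < p := by linarith
  have hq0 : 0 < q := by linarith
  have hθ1 : 0 < 1 - θ := by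
    rw [hθ]
    have := one_div_lt_one_div_of_lt hp0 hpq
    linarith
  set p' := p / (p - 1) with hp'
  have hconj : p'.HolderConjugate p := (Real.HolderConjugate.conjExponent hp).symm
  have hp'0 : 0 < p' := hconj.pos
  have hinv : 1 / p' = 1 - 1 / p := by
    rw [hp']; field_simp
  have hθp' : θ * p' - 1 = p' / q := by
    have : θ = 1 / p' + 1 / q := by rw [hinv, hθ]; ring
    rw [this]; field_simp; ring
  have hb : 1 < θ * p' := by
    have : 0 < p' / q := by positivity
    linarith
  set C₁ := (2 / (θ * p' - 1)) ^ (1 / p') with hC₁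
  have hC₁0 : 0 < C₁ := Real.rpow_pos_of_pos (div_pos two_pos (by linarith)) _
  set C₂ := 2 / (1 - θ) with hC₂
  have hC₂0 : 0 < C₂ := by positivity
  refine ⟨1 / (4 * C₂ * (2 * C₁) ^ (q * (1 - θ))), by positivity, fun F hF hF1 t ht => ?_⟩
  -- The radius `R` is chosen so that Hölder bounds the part of the kernel beyond `R` by `C₁
  -- R^{-1/q} = t/2`. With `K` bounding the mass of the kernel inside `R`, the height `a = t/(4K)`
  -- makes the part of `F` below `a` contribute at most `t/4`. Since `q(1 - θ) = q/p - 1`, `a` is a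
  -- multiple of `t^{q/p}`.
  set R := (t / (2 * C₁)) ^ (-q) with hR
  have hR0 : 0 < R := by positivity
  set K := C₂ * R ^ (1 - θ) with hK
  have hK0 : 0 < K := by positivity
  have hC₁R : C₁ * R ^ (-(1 / q)) = t / 2 := by
    rw [hR, ← Real.rpow_mul (by positivity)]
    have : -q * -(1 / q) = 1 := by field_simp
    rw [this, Real.rpow_one]; field_simp
  have ha : 1 / (4 * C₂ * (2 * C₁) ^ (q * (1 - θ))) * t ^ (q / p) = t / (4 * K) := by
    have h1 : R ^ (1 - θ) = (2 * C₁) ^ (q * (1 - θ)) / t ^ (q * (1 - θ)) := by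
      rw [hR, ← Real.rpow_mul (by positivity), neg_mul, Real.rpow_neg (by positivity),
        Real.div_rpow ht.le (by positivity), inv_div]
    have h2 : q / p = 1 + q * (1 - θ) := by rw [hθ]; field_simp; ring
    rw [hK, h1, h2, Real.rpow_add ht, Real.rpow_one]
    field_simp
  rw [ha]
  set a := t / (4 * K) with ha'
  have ha0 : 0 < a := by positivity
  have hm : MeasurableSet {z : ℝ | |z| < R} := measurableSet_lt (by fun_prop) (by fun_prop)
  set k : ℝ → ℝ≥0∞ := fun z => ‖z‖ₑ ^ (-θ) with hk
  have hkm : Measurable k := by fun_prop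
  set kn := Set.indicator {z : ℝ | |z| < R} k with hkn
  have hknm : Measurable kn := hkm.indicator hm
  set kf := Set.indicator {z : ℝ | |z| < R}ᶜ k with hkf
  have hkfm : Measurable kf := hkm.indicator hm.compl
  have hmF : MeasurableSet {y | ENNReal.ofReal a < F y} := measurableSet_lt measurable_const hF
  set F₂ := Set.indicator {y | ENNReal.ofReal a < F y} F with hF₂
  have hF₂m : Measurable F₂ := hF.indicator hmF
  have hF₂le : ∀ y, F y ≤ ENNReal.ofReal a + F₂ y := by
    intro y
    by_cases h : ENNReal.ofReal a < F y
    · simp [hF₂, h]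
    · simpa [hF₂, Set.indicator, h] using not_lt.1 h
  have hknI : ∫⁻ z, kn z ≤ ENNReal.ofReal K := by
    rw [hkn, lintegral_indicator hm]
    exact lintegral_near_rpow_le (by linarith) hR0
  have hnear : ∀ x, ∫⁻ y, kn (x - y) * ENNReal.ofReal a ≤ ENNReal.ofReal (t / 4) := by
    intro x
    rw [lintegral_mul_const _ (by fun_prop), lintegral_sub_left_eq_self kn x]
    calc _ ≤ ENNReal.ofReal K * ENNReal.ofReal a := by gcongr
      _ = _ := by
        rw [← ENNReal.ofReal_mul hK0.le, ha']; congr 1; field_simp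
  have hfar : ∀ x, ∫⁻ y, kf (x - y) * F y ≤ ENNReal.ofReal (t / 2) := by
    intro x
    have h1 := ENNReal.lintegral_mul_le_Lp_mul_Lq volume hconj
      (f := fun y => kf (x - y)) (g := F) (by fun_prop) hF.aemeasurable
    refine h1.trans ?_
    have h2 : ∫⁻ y, kf (x - y) ^ p' ≤ ENNReal.ofReal (2 / (θ * p' - 1) * R ^ (1 - θ * p')) := by
      rw [lintegral_sub_left_eq_self (fun z => kf z ^ p') x]
      refine le_trans (le_of_eq ?_) (lintegral_far_rpow_le hb hR0)
      rw [← lintegral_indicator hm.compl]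
      refine lintegral_congr fun z => ?_
      by_cases h : |z| < R
      · simp [hkf, h, hp'0]
      · simp only [hkf, hk, Set.indicator, Set.mem_compl_iff, Set.mem_ofPred_eq, h,
          not_false_eq_true, if_true]
        rw [← ENNReal.rpow_mul, neg_mul]
    calc _ ≤ (ENNReal.ofReal (2 / (θ * p' - 1) * R ^ (1 - θ * p'))) ^ (1 / p') * 1 ^ (1 / p) := by
          gcongr
      _ = ENNReal.ofReal (t / 2) := by
          rw [ENNReal.one_rpow, mul_one, ENNReal.ofReal_rpow_of_nonneg (by
            apply mul_nonneg (div_nonneg two_pos.le (by linarith)) (by positivity))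
            (by positivity), Real.mul_rpow (div_nonneg two_pos.le (by linarith)) (by positivity),
            ← hC₁, ← Real.rpow_mul hR0.le, ← hC₁R]
          congr 3
          have : 1 - θ * p' = -(p' / q) := by linarith
          rw [this]; field_simp
  -- The two harmless pieces use up `t/4 + t/2`, so the near kernel acting on the large values of
  -- `F` must supply the last `t/4`; Markov's inequality then applies to that piece alone.
  have hsub : {x : ℝ | ENNReal.ofReal t < ∫⁻ y, ‖x - y‖ₑ ^ (-θ) * F y}
      ⊆ {x | ENNReal.ofReal (t / 4) ≤ ∫⁻ y, kn (x - y) * F₂ y} := by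
    intro x hx
    have hx' : ENNReal.ofReal t < ∫⁻ y, ‖x - y‖ₑ ^ (-θ) * F y := hx
    show ENNReal.ofReal (t / 4) ≤ ∫⁻ y, kn (x - y) * F₂ y
    by_contra hcon
    rw [not_le] at hcon
    have hle : ∫⁻ y, ‖x - y‖ₑ ^ (-θ) * F y ≤
        ∫⁻ y, ((kn (x - y) * ENNReal.ofReal a + kn (x - y) * F₂ y) + kf (x - y) * F y) := by
      refine lintegral_mono fun y => ?_
      have h1 : ‖x - y‖ₑ ^ (-θ) = kn (x - y) + kf (x - y) :=
        (Set.indicator_self_add_compl_apply {z : ℝ | |z| < R} k (x - y)).symm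
      rw [h1, add_mul, ← mul_add]
      gcongr
      exact hF₂le y
    rw [lintegral_add_left (by fun_prop), lintegral_add_left (by fun_prop)] at hle
    have h4 : ENNReal.ofReal t = (ENNReal.ofReal (t / 4) + ENNReal.ofReal (t / 4))
        + ENNReal.ofReal (t / 2) := by
      rw [← ENNReal.ofReal_add (by positivity) (by positivity),
        ← ENNReal.ofReal_add (by positivity) (by positivity)]
      congr 1; ring
    have : ∫⁻ y, ‖x - y‖ₑ ^ (-θ) * F y ≤ ENNReal.ofReal t := by
      rw [h4]
      refine hle.trans ?_
      gcongr
      · exact hnear x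
      · exact hfar x
    exact absurd hx' (not_lt.2 this)
  have hmark := mul_meas_ge_le_lintegral (μ := volume)
    (f := fun x => ∫⁻ y, kn (x - y) * F₂ y) (by
      apply Measurable.lintegral_prod_right' (f := fun z : ℝ × ℝ => kn (z.1 - z.2) * F₂ z.2)
      fun_prop) (ENNReal.ofReal (t / 4))
  rw [lintegral_kernel_sub_mul_eq kn F₂ hknm hF₂m] at hmark
  rw [← lintegral_indicator hmF]
  have ha2 : ENNReal.ofReal a = ENNReal.ofReal (1 / K) * ENNReal.ofReal (t / 4) := by
    rw [← ENNReal.ofReal_mul (by positivity), ha']; congr 1; field_simp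
  calc ENNReal.ofReal a * volume {x : ℝ | ENNReal.ofReal t < ∫⁻ y, ‖x - y‖ₑ ^ (-θ) * F y}
      ≤ ENNReal.ofReal a * volume {x | ENNReal.ofReal (t / 4) ≤ ∫⁻ y, kn (x - y) * F₂ y} := by
        gcongr
    _ ≤ ENNReal.ofReal (1 / K) * (ENNReal.ofReal K * ∫⁻ y, F₂ y) := by
        rw [ha2, mul_assoc]
        exact mul_le_mul' le_rfl (hmark.trans (mul_le_mul' hknI le_rfl))
    _ = ∫⁻ y, F₂ y := by
        rw [← mul_assoc, ← ENNReal.ofReal_mul (by positivity), one_div_mul_cancel hK0.ne',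
          ENNReal.ofReal_one, one_mul]

/-- One-dimensional Hardy–Littlewood–Sobolev inequality for functions of norm at most one. -/
theorem lintegral_fractionalIntegral_rpow_le {p q θ : ℝ} (hp : 1 < p) (hpq : p < q)
    (hθ : θ = 1 + 1 / q - 1 / p) :
    ∃ C : ℝ, 0 < C ∧ ∀ F : ℝ → ℝ≥0∞, Measurable F → ∫⁻ y, F y ^ p ≤ 1 →
      ∫⁻ x : ℝ, (∫⁻ y, ‖x - y‖ₑ ^ (-θ) * F y) ^ q ≤ ENNReal.ofReal C := by
  obtain ⟨c, hc, hdist⟩ := meas_fractionalIntegral_gt_le hp hpq hθ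
  have hp0 : 0 < p := by linarith
  have hq0 : 0 < q := by linarith
  -- The layer-cake weight factors as `t^{q-1} = t^{r-1} · t^{q/p}`, the last factor being the one
  -- in the superlevel estimate. After exchanging integrals, the `t`-integral up to `(F/c)^{p/q}`
  -- gives `(F/c)^{rp/q} = (F/c)^{p-1}`, which combines with the remaining `F` into `F^p`.
  set r := q - q / p with hr
  have hr0 : 0 < r := by
    have : q / p < q := div_lt_self hq0 hp
    linarith
  refine ⟨q / (c * r) * (1 / c) ^ (p - 1), by positivity, fun F hF hF1 => ?_⟩
  set U : ℝ → ℝ≥0∞ := fun x => ∫⁻ y, ‖x - y‖ₑ ^ (-θ) * F y with hU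
  have hUm : Measurable U := by
    apply Measurable.lintegral_prod_right' (f := fun z : ℝ × ℝ => ‖z.1 - z.2‖ₑ ^ (-θ) * F z.2)
    fun_prop
  have h1 : ∫⁻ x, U x ^ q = ∫⁻ t in Set.Ioi (0 : ℝ),
      ENNReal.ofReal (q * t ^ (q - 1)) * volume {x | ENNReal.ofReal t < U x} := by
    simp_rw [fun x => ENNReal.rpow_eq_lintegral_lt (U x) hq0]
    rw [lintegral_lintegral_swap]
    · refine lintegral_congr fun t => ?_
      have hmt : MeasurableSet {x | ENNReal.ofReal t < U x} :=
        measurableSet_lt measurable_const hUm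
      rw [← lintegral_indicator_const hmt]
      rfl
    · have hms : MeasurableSet {z : ℝ × ℝ | ENNReal.ofReal z.2 < U z.1} :=
        measurableSet_lt (by fun_prop) (by fun_prop)
      have : Measurable (Set.indicator {z : ℝ × ℝ | ENNReal.ofReal z.2 < U z.1}
        (fun z => ENNReal.ofReal (q * z.2 ^ (q - 1)))) := Measurable.indicator (by fun_prop) hms
      exact this.aemeasurable
  have h2 : ∀ t ∈ Set.Ioi (0 : ℝ), ENNReal.ofReal (q * t ^ (q - 1)) *
      volume {x | ENNReal.ofReal t < U x} ≤ ∫⁻ y, ENNReal.ofReal (q / (c * r)) * (F y *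
        Set.indicator {t : ℝ | ENNReal.ofReal t < (ENNReal.ofReal (1 / c) * F y) ^ (p / q)}
          (fun t => ENNReal.ofReal (r * t ^ (r - 1))) t) := by
    intro t ht
    have ht0 : 0 < t := ht
    have hsplit : ENNReal.ofReal (q * t ^ (q - 1)) =
        ENNReal.ofReal (q / (c * r)) * ENNReal.ofReal (r * t ^ (r - 1)) *
          ENNReal.ofReal (c * t ^ (q / p)) := by
      rw [← ENNReal.ofReal_mul (by positivity), ← ENNReal.ofReal_mul (by positivity)]
      congr 1
      have : q - 1 = (r - 1) + q / p := by rw [hr]; ring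
      rw [this, Real.rpow_add ht0]; field_simp
    have hmF : MeasurableSet {y | ENNReal.ofReal (c * t ^ (q / p)) < F y} :=
      measurableSet_lt measurable_const hF
    rw [hsplit, mul_assoc]
    refine (mul_le_mul_right (hdist F hF hF1 t ht0) _).trans (le_of_eq ?_)
    rw [← lintegral_indicator hmF, ← lintegral_const_mul _ (hF.indicator hmF)]
    refine lintegral_congr fun y => ?_
    have hiff : ENNReal.ofReal (c * t ^ (q / p)) < F y ↔
        ENNReal.ofReal t < (ENNReal.ofReal (1 / c) * F y) ^ (p / q) := by
      rw [← ENNReal.rpow_lt_rpow_iff (z := p / q) (by positivity) (x := ENNReal.ofReal _),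
        ENNReal.mul_rpow_of_nonneg _ _ (by positivity),
        ENNReal.ofReal_rpow_of_pos (by positivity), ENNReal.ofReal_rpow_of_pos (by positivity),
        Real.mul_rpow hc.le (by positivity), ← Real.rpow_mul ht0.le]
      have : q / p * (p / q) = 1 := by field_simp
      rw [this, Real.rpow_one, ENNReal.ofReal_mul (by positivity)]
      have hcc : ENNReal.ofReal (c ^ (p / q)) * ENNReal.ofReal ((1 / c) ^ (p / q)) = 1 := by
        rw [← ENNReal.ofReal_mul (by positivity), ← Real.mul_rpow hc.le (by positivity),
          mul_one_div_cancel hc.ne', Real.one_rpow, ENNReal.ofReal_one]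
      have hne : ENNReal.ofReal (c ^ (p / q)) ≠ 0 := by
        rw [Ne, ENNReal.ofReal_eq_zero, not_le]; positivity
      constructor
      · intro h
        rw [← ENNReal.mul_lt_mul_iff_right hne ENNReal.ofReal_ne_top, ← mul_assoc, hcc, one_mul]
        exact h
      · intro h
        rw [← ENNReal.mul_lt_mul_iff_right hne ENNReal.ofReal_ne_top, ← mul_assoc, hcc,
          one_mul] at h
        exact h
    by_cases h : ENNReal.ofReal (c * t ^ (q / p)) < F y
    · simp only [Set.indicator, Set.mem_ofPred_eq, h, hiff.1 h, if_true]
      ring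
    · have h' := mt hiff.2 h
      simp only [Set.indicator, Set.mem_ofPred_eq, h, h', if_false, mul_zero]
  have hmeas : Measurable (fun z : ℝ × ℝ => Set.indicator
      {z : ℝ × ℝ | ENNReal.ofReal z.1 < (ENNReal.ofReal (1 / c) * F z.2) ^ (p / q)}
      (fun z => ENNReal.ofReal (r * z.1 ^ (r - 1))) z) := by
    refine Measurable.indicator (by fun_prop) (measurableSet_lt (by fun_prop) (by fun_prop))
  rw [h1]
  refine (setLIntegral_mono' measurableSet_Ioi h2).trans ?_
  rw [lintegral_lintegral_swap]
  swap
  · have hmeas2 : Measurable (fun z : ℝ × ℝ => ENNReal.ofReal (q / (c * r)) * (F z.2 *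
      Set.indicator
      {z : ℝ × ℝ | ENNReal.ofReal z.1 < (ENNReal.ofReal (1 / c) * F z.2) ^ (p / q)}
      (fun z => ENNReal.ofReal (r * z.1 ^ (r - 1))) z)) := by fun_prop
    exact hmeas2.aemeasurable
  have h3 : ∀ y, ∫⁻ t in Set.Ioi (0 : ℝ), ENNReal.ofReal (q / (c * r)) * (F y *
        Set.indicator {t : ℝ | ENNReal.ofReal t < (ENNReal.ofReal (1 / c) * F y) ^ (p / q)}
          (fun t => ENNReal.ofReal (r * t ^ (r - 1))) t) =
      ENNReal.ofReal (q / (c * r) * (1 / c) ^ (p - 1)) * F y ^ p := by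
    intro y
    have hmi : Measurable (fun t : ℝ => Set.indicator
        {t : ℝ | ENNReal.ofReal t < (ENNReal.ofReal (1 / c) * F y) ^ (p / q)}
          (fun t => ENNReal.ofReal (r * t ^ (r - 1))) t) :=
      Measurable.indicator (by fun_prop) (measurableSet_lt (by fun_prop) (by fun_prop))
    rw [lintegral_const_mul _ (hmi.const_mul _), lintegral_const_mul _ hmi,
      ← ENNReal.rpow_eq_lintegral_lt _ hr0, ← ENNReal.rpow_mul,
      ENNReal.mul_rpow_of_nonneg _ _ (by positivity), ENNReal.ofReal_rpow_of_pos (by positivity),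
      ENNReal.ofReal_mul (by positivity)]
    have he : p / q * r = p - 1 := by rw [hr]; field_simp
    rw [he]
    have hFp : F y ^ p = F y * F y ^ (p - 1) := by
      conv_lhs => rw [show p = 1 + (p - 1) by ring]
      rw [ENNReal.rpow_add_of_nonneg _ _ zero_le_one (by linarith), ENNReal.rpow_one]
    rw [hFp]; ring
  simp_rw [h3]
  rw [lintegral_const_mul _ (by fun_prop)]
  calc _ ≤ ENNReal.ofReal (q / (c * r) * (1 / c) ^ (p - 1)) * 1 := by gcongr
    _ = _ := mul_one _

/-- One-dimensional Hardy–Littlewood–Sobolev inequality. -/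
theorem fractionalIntegral_Lp_Lq {p q θ : ℝ} (hp : 1 < p) (hpq : p < q)
    (hθ : θ = 1 + 1 / q - 1 / p) :
    ∃ C : ℝ, 0 < C ∧ ∀ F : ℝ → ℝ≥0∞, Measurable F →
      (∫⁻ x : ℝ, (∫⁻ y, ‖x - y‖ₑ ^ (-θ) * F y) ^ q) ^ (1 / q)
        ≤ ENNReal.ofReal C * (∫⁻ y, F y ^ p) ^ (1 / p) := by
  obtain ⟨C, hC, h⟩ := lintegral_fractionalIntegral_rpow_le hp hpq hθ
  have hp0 : 0 < p := by linarith
  have hq0 : 0 < q := by linarith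
  refine ⟨C ^ (1 / q), by positivity, fun F hF => ?_⟩
  set N := (∫⁻ y, F y ^ p) ^ (1 / p) with hN
  by_cases hN0 : N = 0
  · have h0 : ∫⁻ y, F y ^ p = 0 := by
      rw [hN, ENNReal.rpow_eq_zero_iff_of_pos (by positivity)] at hN0
      exact hN0
    rw [lintegral_eq_zero_iff (by fun_prop)] at h0
    have h0' : ∀ᵐ y, F y = 0 := by
      filter_upwards [h0] with y hy
      exact (ENNReal.rpow_eq_zero_iff_of_pos hp0).1 hy
    have : ∀ x : ℝ, ∫⁻ y, ‖x - y‖ₑ ^ (-θ) * F y = 0 := by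
      intro x
      rw [lintegral_congr_ae (g := fun _ => 0), lintegral_zero]
      filter_upwards [h0'] with y hy
      rw [hy, mul_zero]
    simp [this, hq0]
  by_cases hNt : N = ⊤
  · rw [hNt, ENNReal.mul_top]
    · exact le_top
    · rw [Ne, ENNReal.ofReal_eq_zero, not_le]; positivity
  -- Both sides are homogeneous of degree one in `F`, and `N` is now neither `0` nor `∞`.
  have hscale : ∫⁻ y, (N⁻¹ * F y) ^ p ≤ 1 := by
    simp_rw [ENNReal.mul_rpow_of_nonneg _ _ hp0.le]
    rw [lintegral_const_mul _ (by fun_prop)]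
    have : ∫⁻ y, F y ^ p = N ^ p := by
      rw [hN, ← ENNReal.rpow_mul, one_div_mul_cancel hp0.ne', ENNReal.rpow_one]
    rw [this, ← ENNReal.mul_rpow_of_nonneg _ _ hp0.le, ENNReal.inv_mul_cancel hN0 hNt,
      ENNReal.one_rpow]
  have h1 := h (fun y => N⁻¹ * F y) (by fun_prop) hscale
  have h2 : ∀ x : ℝ, ∫⁻ y, ‖x - y‖ₑ ^ (-θ) * F y =
      N * ∫⁻ y, ‖x - y‖ₑ ^ (-θ) * (N⁻¹ * F y) := by
    intro x
    rw [← lintegral_const_mul _ (by fun_prop)]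
    refine lintegral_congr fun y => ?_
    rw [← mul_assoc, ← mul_assoc, mul_comm N, mul_assoc _ N, ENNReal.mul_inv_cancel hN0 hNt, mul_one]
  simp_rw [h2, ENNReal.mul_rpow_of_nonneg _ _ hq0.le]
  rw [lintegral_const_mul' _ _ (ENNReal.rpow_ne_top_of_nonneg hq0.le hNt),
    ENNReal.mul_rpow_of_nonneg _ _ (by positivity), ← ENNReal.rpow_mul,
    mul_one_div_cancel hq0.ne', ENNReal.rpow_one, mul_comm]
  refine mul_le_mul' ?_ le_rfl
  rw [← ENNReal.ofReal_rpow_of_pos hC]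
  exact ENNReal.rpow_le_rpow h1 (by positivity)

/-- Young's inequality `L¹ * Lᵖ ⊆ Lᵖ` on the line. -/
theorem convolution_Lp_le {p : ℝ} (hp : 1 < p) {k F : ℝ → ℝ≥0∞} (hk : Measurable k)
    (hF : Measurable F) :
    (∫⁻ x : ℝ, (∫⁻ y, k (x - y) * F y) ^ p) ^ (1 / p)
      ≤ (∫⁻ z, k z) * (∫⁻ y, F y ^ p) ^ (1 / p) := by
  have hp0 : 0 < p := by linarith
  set p' := p / (p - 1) with hp'
  have hconj : p'.HolderConjugate p := (Real.HolderConjugate.conjExponent hp).symm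
  have hp'0 : 0 < p' := hconj.pos
  have hinv : 1 / p' = 1 - 1 / p := by
    rw [hp']; field_simp
  set I := ∫⁻ z, k z with hI
  have h1 : ∀ x, (∫⁻ y, k (x - y) * F y) ^ p ≤ I ^ (p - 1) * ∫⁻ y, k (x - y) * F y ^ p := by
    intro x
    -- Hölder with `k = k^{1/p'} · k^{1/p}`: the first factor yields the mass of `k`, the second
    -- keeps one power of `k` next to `F^p` for Tonelli.
    have hh := ENNReal.lintegral_mul_le_Lp_mul_Lq volume hconj
      (f := fun y => k (x - y) ^ (1 / p')) (g := fun y => k (x - y) ^ (1 / p) * F y)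
      (by fun_prop) (by fun_prop)
    have e1 : ∀ y, ((fun y => k (x - y) ^ (1 / p')) * fun y => k (x - y) ^ (1 / p) * F y) y
        = k (x - y) * F y := by
      intro y
      simp only [Pi.mul_apply]
      rw [← mul_assoc, ← ENNReal.rpow_add_of_nonneg _ _ (by positivity) (by positivity), hinv,
        sub_add_cancel, ENNReal.rpow_one]
    have e2 : ∀ y, (k (x - y) ^ (1 / p')) ^ p' = k (x - y) := by
      intro y
      rw [← ENNReal.rpow_mul, one_div_mul_cancel hp'0.ne', ENNReal.rpow_one]
    have e3 : ∀ y, (k (x - y) ^ (1 / p) * F y) ^ p = k (x - y) * F y ^ p := by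
      intro y
      rw [ENNReal.mul_rpow_of_nonneg _ _ hp0.le, ← ENNReal.rpow_mul, one_div_mul_cancel hp0.ne',
        ENNReal.rpow_one]
    simp_rw [e1, e2, e3] at hh
    rw [lintegral_sub_left_eq_self k x] at hh
    refine (ENNReal.rpow_le_rpow hh hp0.le).trans (le_of_eq ?_)
    rw [ENNReal.mul_rpow_of_nonneg _ _ hp0.le, ← ENNReal.rpow_mul, ← ENNReal.rpow_mul,
      one_div_mul_cancel hp0.ne', ENNReal.rpow_one, hinv]
    congr 2
    field_simp
  have h2 : ∫⁻ x : ℝ, (∫⁻ y, k (x - y) * F y) ^ p ≤ I ^ (p - 1) * (I * ∫⁻ y, F y ^ p) := by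
    refine (lintegral_mono h1).trans (le_of_eq ?_)
    rw [lintegral_const_mul, lintegral_kernel_sub_mul_eq k (fun y => F y ^ p) hk (by fun_prop)]
    apply Measurable.lintegral_prod_right' (f := fun z : ℝ × ℝ => k (z.1 - z.2) * F z.2 ^ p)
    fun_prop
  have h3 : I ^ (p - 1) * (I * ∫⁻ y, F y ^ p) = I ^ p * ∫⁻ y, F y ^ p := by
    rw [← mul_assoc]
    congr 1
    conv_rhs => rw [show p = (p - 1) + 1 by ring]
    rw [ENNReal.rpow_add_of_nonneg _ _ (by linarith) zero_le_one, ENNReal.rpow_one]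
  rw [h3] at h2
  refine (ENNReal.rpow_le_rpow h2 (by positivity)).trans (le_of_eq ?_)
  rw [ENNReal.mul_rpow_of_nonneg _ _ (by positivity), ← ENNReal.rpow_mul,
    mul_one_div_cancel hp0.ne', ENNReal.rpow_one]

/-! ### The exponentially damped power kernel. -/

/-- The kernel `e^{-ε|z|} |z|^{-θ}` on the line. -/
noncomputable def expRieszKernel (ε θ z : ℝ) : ℝ≥0∞ :=
  ENNReal.ofReal (Real.exp (-(ε * |z|))) * ‖z‖ₑ ^ (-θ)

theorem measurable_expRieszKernel (ε θ : ℝ) : Measurable (expRieszKernel ε θ) := by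
  unfold expRieszKernel
  fun_prop

/-- For `|z| < 1` the power is integrable because `θ < 1`; for `|z| ≥ 1` it is at most one and the
exponential is integrable. -/
theorem lintegral_expRieszKernel_lt_top {ε θ : ℝ} (hε : 0 < ε) (hθ0 : 0 < θ) (hθ : θ < 1) :
    ∫⁻ z, expRieszKernel ε θ z < ⊤ := by
  have hm : MeasurableSet {z : ℝ | |z| < 1} := measurableSet_lt (by fun_prop) (by fun_prop)
  rw [← lintegral_add_compl _ hm]
  refine ENNReal.add_lt_top.2 ⟨?_, ?_⟩
  · refine lt_of_le_of_lt ?_ (lt_of_le_of_lt (lintegral_near_rpow_le hθ one_pos)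
      ENNReal.ofReal_lt_top)
    refine lintegral_mono fun z => ?_
    refine mul_le_of_le_one_left (zero_le) ?_
    rw [ENNReal.ofReal_le_one, Real.exp_le_one_iff]
    have := abs_nonneg z
    nlinarith [mul_nonneg hε.le this]
  · have h1 : ∫⁻ z in {z : ℝ | |z| < 1}ᶜ, expRieszKernel ε θ z
        ≤ ∫⁻ z : ℝ, ENNReal.ofReal (Real.exp (-(ε * |z|))) := by
      refine (setLIntegral_mono' hm.compl fun z hz => ?_).trans (setLIntegral_le_lintegral _ _)
      refine mul_le_of_le_one_right (zero_le) ?_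
      have hz1 : 1 ≤ |z| := not_lt.1 hz
      rw [ENNReal.rpow_neg, ENNReal.inv_le_one]
      refine ENNReal.one_le_rpow ?_ hθ0
      rw [Real.enorm_eq_ofReal_abs]
      exact ENNReal.one_le_ofReal.2 hz1
    refine h1.trans_lt ?_
    have h2 := lintegral_le_two_mul_of_abs (fun z => ENNReal.ofReal (Real.exp (-(ε * z))))
    refine h2.trans_lt (ENNReal.mul_lt_top (by simp) ?_)
    have h3 := exp_neg_integrableOn_Ioi 0 hε
    have h4 := h3.lintegral_lt_top
    simpa [neg_mul] using h4

/-- Convolution with `e^{-ε|z|} |z|^{-θ}` maps `Lᵖ` to `L^q` for a suitable `θ ≥ 1 - s`. -/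
theorem exists_expRieszKernel_Lp_Lq {p q s ε : ℝ} (hp : 1 < p) (hpq : p ≤ q) (hs : 0 < s)
    (hpqs : 1 / p - s ≤ 1 / q) (hε : 0 < ε) :
    ∃ θ : ℝ, 0 < θ ∧ θ < 1 ∧ 1 - s ≤ θ ∧ ∃ C : ℝ, 0 < C ∧ ∀ F : ℝ → ℝ≥0∞, Measurable F →
      (∫⁻ x : ℝ, (∫⁻ y, expRieszKernel ε θ (x - y) * F y) ^ q) ^ (1 / q)
        ≤ ENNReal.ofReal C * (∫⁻ y, F y ^ p) ^ (1 / p) := by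
  have hp0 : 0 < p := by linarith
  rcases hpq.eq_or_lt with rfl | hlt
  · have hmax : max (1 - s) (1 / 2) < 1 := max_lt (by linarith) (by norm_num)
    have hmax0 : 0 < max (1 - s) (1 / 2) := lt_max_of_lt_right (by norm_num)
    -- When `q = p` any `θ` in `(0, 1)` with `θ ≥ 1 - s` works; the `1/2` keeps it positive when `s
    -- ≥ 1`.
    refine ⟨max (1 - s) (1 / 2), hmax0, hmax, le_max_left _ _, ?_⟩
    have hfin := lintegral_expRieszKernel_lt_top hε hmax0 hmax
    set I := ∫⁻ z, expRieszKernel ε (max (1 - s) (1 / 2)) z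
    refine ⟨I.toReal + 1, by positivity, fun F hF => ?_⟩
    refine (convolution_Lp_le hp (measurable_expRieszKernel _ _) hF).trans ?_
    gcongr
    rw [ENNReal.le_ofReal_iff_toReal_le hfin.ne (by positivity)]
    linarith
  · have hq0 : 0 < q := by linarith
    have h1 := one_div_lt_one_div_of_lt hp0 hlt
    have h2 : 1 / p < 1 := by rw [div_lt_one hp0]; exact hp
    have h3 : 0 < 1 / q := by positivity
    obtain ⟨C, hC, h⟩ := fractionalIntegral_Lp_Lq hp hlt rfl
    -- When `p < q` scaling forces `θ`, and the exponential factor is discarded.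
    refine ⟨1 + 1 / q - 1 / p, by linarith, by linarith, by linarith, C, hC, fun F hF => ?_⟩
    refine le_trans ?_ (h F hF)
    gcongr with x y
    refine mul_le_of_le_one_left (zero_le) ?_
    rw [ENNReal.ofReal_le_one, Real.exp_le_one_iff]
    have := mul_nonneg hε.le (abs_nonneg (x - y))
    linarith

/-! ### Spherical caps and spherical averages of the Riesz kernel. -/

open scoped Pointwise in
/-- Spherical caps of radius `ρ` have measure `O(ρ^{n-1})`. -/
theorem toSphere_cap_le (n : ℕ) (e : EuclideanSpace ℝ (Fin n)) (he : ‖e‖ = 1) {ρ : ℝ}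
    (hρ : 0 < ρ) :
    (volume : Measure (EuclideanSpace ℝ (Fin n))).toSphere {ω | ‖(ω : EuclideanSpace ℝ (Fin n)) - e‖ < ρ}
      ≤ ENNReal.ofReal (n * 2 ^ n * ρ ^ (n - 1)) := by
  have hn : n ≠ 0 := by
    rintro rfl
    rw [Subsingleton.elim e 0, norm_zero] at he
    exact zero_ne_one he
  let i₀ : Fin n := ⟨0, Nat.pos_of_ne_zero hn⟩
  obtain ⟨b, hb⟩ := Orthonormal.exists_orthonormalBasis_extension_of_card_eq (𝕜 := ℝ)
    (E := EuclideanSpace ℝ (Fin n)) (ι := Fin n) (by simp) (v := fun _ => e) (s := {i₀}) (by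
      rw [orthonormal_iff_ite]
      rintro ⟨i, hi⟩ ⟨j, hj⟩
      rw [Set.mem_singleton_iff] at hi hj
      subst hi; subst hj
      simp [he])
  have hb0 : b i₀ = e := hb i₀ rfl
  have hms : MeasurableSet {ω : Metric.sphere (0 : EuclideanSpace ℝ (Fin n)) 1 |
      ‖(ω : EuclideanSpace ℝ (Fin n)) - e‖ < ρ} := measurableSet_lt (by fun_prop) (by fun_prop)
  rw [Measure.toSphere_apply' _ hms]
  -- The sphere measure of the cap is `n` times the volume of the cone over it. In an orthonormal
  -- basis containing `e`, the cone lies in this box: the other coordinates of `ω` are those of `ω -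
  -- e`, hence less than `ρ` in size.
  set Q : Set (Fin n → ℝ) := Set.Icc (fun i => if i = i₀ then -1 else -ρ)
    (fun i => if i = i₀ then 1 else ρ) with hQ
  have hsub : Set.Ioo (0 : ℝ) 1 • ((↑) '' {ω : Metric.sphere (0 : EuclideanSpace ℝ (Fin n)) 1 |
      ‖(ω : EuclideanSpace ℝ (Fin n)) - e‖ < ρ}) ⊆
      (fun x => (b.repr x).ofLp) ⁻¹' Q := by
    rintro _ ⟨t, ht, _, ⟨ω, hω, rfl⟩, rfl⟩
    have hω' : ‖(ω : EuclideanSpace ℝ (Fin n)) - e‖ < ρ := hω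
    have hω1 : ‖(ω : EuclideanSpace ℝ (Fin n))‖ = 1 := by simp
    have habs : ∀ i, |(b.repr (t • (ω : EuclideanSpace ℝ (Fin n)))).ofLp i| ≤
        if i = i₀ then 1 else ρ := by
      intro i
      rw [b.repr_apply_apply, inner_smul_right, abs_mul, abs_of_pos ht.1]
      split_ifs with hi
      · have := abs_real_inner_le_norm (b i) (ω : EuclideanSpace ℝ (Fin n))
        rw [b.norm_eq_one, hω1] at this
        nlinarith [ht.1, ht.2, abs_nonneg (inner ℝ (b i) (ω : EuclideanSpace ℝ (Fin n)))]
      · have h0 : inner ℝ (b i) e = 0 := by rw [← hb0]; exact b.orthonormal.2 hi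
        have h1 : inner ℝ (b i) (ω : EuclideanSpace ℝ (Fin n))
            = inner ℝ (b i) ((ω : EuclideanSpace ℝ (Fin n)) - e) := by
          rw [inner_sub_right, h0, sub_zero]
        have := abs_real_inner_le_norm (b i) ((ω : EuclideanSpace ℝ (Fin n)) - e)
        rw [b.norm_eq_one, one_mul, ← h1] at this
        nlinarith [ht.1, ht.2, abs_nonneg (inner ℝ (b i) (ω : EuclideanSpace ℝ (Fin n)))]
    show (b.repr (t • (ω : EuclideanSpace ℝ (Fin n)))).ofLp ∈ Q
    rw [hQ, Set.mem_Icc]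
    constructor
    · intro i
      have := (abs_le.1 (habs i)).1
      show (if i = i₀ then (-1 : ℝ) else -ρ) ≤ _
      split_ifs at this ⊢ <;> exact this
    · intro i
      exact (abs_le.1 (habs i)).2
  have hmp : MeasurePreserving (fun x => (b.repr x).ofLp) (volume) (volume : Measure (Fin n → ℝ)) :=
    (PiLp.volume_preserving_ofLp (Fin n)).comp b.measurePreserving_repr
  have hvol : volume ((fun x => (b.repr x).ofLp) ⁻¹' Q) = ENNReal.ofReal (2 ^ n * ρ ^ (n - 1)) := by
    rw [hmp.measure_preimage measurableSet_Icc.nullMeasurableSet, Real.volume_Icc_pi,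
      ← ENNReal.ofReal_prod_of_nonneg]
    · congr 1
      have : ∀ i : Fin n, ((if i = i₀ then (1 : ℝ) else ρ) - if i = i₀ then (-1 : ℝ) else -ρ) =
          2 * (if i = i₀ then 1 else ρ) := by
        intro i; split_ifs <;> ring
      simp_rw [this]
      rw [Finset.prod_mul_distrib, Finset.prod_ite]
      simp [Finset.filter_ne', Finset.card_erase_of_mem]
    · intro i _
      split_ifs <;> linarith
  calc _ ≤ (Module.finrank ℝ (EuclideanSpace ℝ (Fin n)) : ℝ≥0∞) *
        volume ((fun x => (b.repr x).ofLp) ⁻¹' Q) := by gcongr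
    _ = ENNReal.ofReal (n * 2 ^ n * ρ ^ (n - 1)) := by
      rw [hvol, finrank_euclideanSpace_fin, mul_assoc, ENNReal.ofReal_mul (Nat.cast_nonneg n),
        ENNReal.ofReal_natCast]

/-- Layer cake with `a = n - 1 + θ`: the superlevel set at height `t` lies in a cap of radius
`t^{-1/a}`, of measure `O(t^{-η})` with `η = (n-1)/a < 1`, and is empty once `t ≥ δ^{-a}`.
Integrating gives `δ^{-a(1-η)} = δ^{-θ}`. -/
theorem lintegral_sphere_dist_rpow_le (n : ℕ) {θ : ℝ} (hθ0 : 0 < θ) :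
    ∃ C : ℝ, 0 < C ∧ ∀ e : EuclideanSpace ℝ (Fin n), ‖e‖ = 1 → ∀ δ : ℝ, 0 < δ →
      ∫⁻ ω, ENNReal.ofReal ((δ + ‖(ω : EuclideanSpace ℝ (Fin n)) - e‖) ^ (-(((n - 1 : ℕ) : ℝ) + θ)))
        ∂(volume : Measure (EuclideanSpace ℝ (Fin n))).toSphere
      ≤ ENNReal.ofReal (C * δ ^ (-θ)) := by
  set m : ℝ := ((n - 1 : ℕ) : ℝ) with hm
  have hm0 : 0 ≤ m := Nat.cast_nonneg _
  set a := m + θ with ha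
  have ha0 : 0 < a := by positivity
  set η := m / a with hη
  have hη1 : η < 1 := by rw [hη, div_lt_one ha0]; linarith
  have h1η : 0 < 1 - η := by linarith
  refine ⟨(n * 2 ^ n + 1) * (2 / (1 - η)), by positivity, fun e he δ hδ => ?_⟩
  rw [lintegral_eq_lintegral_meas_lt _ (Filter.Eventually.of_forall fun ω => by positivity)
    (Measurable.aemeasurable (by fun_prop))]
  set R := δ ^ (-a) with hR
  have hR0 : 0 < R := by positivity
  calc _ ≤ ∫⁻ t in Set.Ioi (0 : ℝ), Set.indicator {z : ℝ | |z| < R}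
          (fun z => ENNReal.ofReal (n * 2 ^ n + 1) * ‖z‖ₑ ^ (-η)) t := by
        refine setLIntegral_mono' measurableSet_Ioi fun t ht => ?_
        have ht0 : 0 < t := ht
        by_cases htR : t < R
        · have hmem : t ∈ {z : ℝ | |z| < R} := by simpa [abs_of_pos ht0] using htR
          rw [Set.indicator_of_mem hmem]
          have hρ : 0 < t ^ (-(1 / a)) := by positivity
          refine (measure_mono (t := {ω : Metric.sphere (0 : EuclideanSpace ℝ (Fin n)) 1 |
              ‖(ω : EuclideanSpace ℝ (Fin n)) - e‖ < t ^ (-(1 / a))})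
            fun ω hω => ?_).trans ((toSphere_cap_le n e he hρ).trans ?_)
          · have hω' : t < (δ + ‖(ω : EuclideanSpace ℝ (Fin n)) - e‖) ^ (-a) := hω
            show ‖(ω : EuclideanSpace ℝ (Fin n)) - e‖ < t ^ (-(1 / a))
            have h1 := Real.rpow_lt_rpow_of_neg ht0 hω' (z := -(1 / a))
              (by have : 0 < 1 / a := by positivity
                  linarith)
            rw [← Real.rpow_mul (by positivity)] at h1
            have : -a * -(1 / a) = 1 := by field_simp
            rw [this, Real.rpow_one] at h1
            linarith
          · rw [Real.enorm_eq_ofReal_abs, abs_of_pos ht0, ENNReal.ofReal_rpow_of_pos ht0,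
              ← ENNReal.ofReal_mul (by positivity)]
            have : (t ^ (-(1 / a))) ^ (n - 1) = t ^ (-η) := by
              rw [← Real.rpow_natCast, ← Real.rpow_mul ht0.le]
              congr 1
              rw [hη, ← hm]; ring
            rw [this]
            gcongr
            linarith
        · have : {ω : Metric.sphere (0 : EuclideanSpace ℝ (Fin n)) 1 |
              t < (δ + ‖(ω : EuclideanSpace ℝ (Fin n)) - e‖) ^ (-a)} = ∅ := by
            rw [Set.eq_empty_iff_forall_notMem]
            intro ω hω
            have hω' : t < (δ + ‖(ω : EuclideanSpace ℝ (Fin n)) - e‖) ^ (-a) := hω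
            have h2 := Real.rpow_le_rpow_of_nonpos hδ
              (le_add_of_nonneg_right (norm_nonneg ((ω : EuclideanSpace ℝ (Fin n)) - e)))
              (z := -a) (by linarith)
            exact htR (hω'.trans_le h2)
          rw [this, measure_empty]
          exact zero_le
    _ ≤ ∫⁻ t : ℝ, Set.indicator {z : ℝ | |z| < R}
          (fun z => ENNReal.ofReal (n * 2 ^ n + 1) * ‖z‖ₑ ^ (-η)) t := setLIntegral_le_lintegral _ _
    _ = ENNReal.ofReal (n * 2 ^ n + 1) * ∫⁻ t in {z : ℝ | |z| < R}, ‖t‖ₑ ^ (-η) := by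
        rw [lintegral_indicator (measurableSet_lt (by fun_prop) (by fun_prop)),
          lintegral_const_mul _ (by fun_prop)]
    _ ≤ ENNReal.ofReal (n * 2 ^ n + 1) * ENNReal.ofReal (2 / (1 - η) * R ^ (1 - η)) := by
        gcongr
        exact lintegral_near_rpow_le hη1 hR0
    _ = _ := by
        rw [← ENNReal.ofReal_mul (by positivity), ← mul_assoc]
        congr 2
        rw [hR, ← Real.rpow_mul hδ.le]
        congr 1
        rw [hη]; field_simp; rw [ha]; ring

/-- This separates radial and angular distance. With `t = e^w` and `X = ‖tω - e‖`, the radial term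
equals `|t - 1| ≤ X`, and the angular term is at most `X + |t - 1| ≤ 2X`. -/
theorem three_mul_norm_smul_sub_ge {n : ℕ} {ω e : EuclideanSpace ℝ (Fin n)} (hω : ‖ω‖ = 1)
    (he : ‖e‖ = 1) (w : ℝ) :
    max (Real.exp w) 1 * ((1 - Real.exp (-|w|)) + ‖ω - e‖) ≤ 3 * ‖Real.exp w • ω - e‖ := by
  set t := Real.exp w with ht
  have ht0 : 0 < t := Real.exp_pos w
  have h1 : |t - 1| ≤ ‖t • ω - e‖ := by
    have := abs_norm_sub_norm_le (t • ω) e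
    rwa [norm_smul, hω, he, Real.norm_of_nonneg ht0.le, mul_one] at this
  have h2 : ‖ω - e‖ ≤ ‖t • ω - e‖ + |t - 1| := by
    have : ω - e = (t • ω - e) - (t - 1) • ω := by module
    calc ‖ω - e‖ = ‖(t • ω - e) - (t - 1) • ω‖ := by rw [← this]
      _ ≤ ‖t • ω - e‖ + ‖(t - 1) • ω‖ := norm_sub_le _ _
      _ = _ := by rw [norm_smul, hω, mul_one, Real.norm_eq_abs]
  have h3 : t * ‖ω - e‖ ≤ ‖t • ω - e‖ + |t - 1| := by
    have : t • (ω - e) = (t • ω - e) - (t - 1) • e := by module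
    calc t * ‖ω - e‖ = ‖t • (ω - e)‖ := by rw [norm_smul, Real.norm_of_nonneg ht0.le]
      _ = ‖(t • ω - e) - (t - 1) • e‖ := by rw [← this]
      _ ≤ ‖t • ω - e‖ + ‖(t - 1) • e‖ := norm_sub_le _ _
      _ = _ := by rw [norm_smul, he, mul_one, Real.norm_eq_abs]
  rcases le_total 0 w with hw | hw
  · have ht1 : 1 ≤ t := Real.one_le_exp hw
    rw [max_eq_left ht1, abs_of_nonneg hw, Real.exp_neg, ← ht]
    rw [abs_of_nonneg (by linarith)] at h1 h3
    have : t * (1 - t⁻¹ + ‖ω - e‖) = t - 1 + t * ‖ω - e‖ := by field_simp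
    linarith
  · have ht1 : t ≤ 1 := Real.exp_le_one_iff.2 hw
    rw [max_eq_right ht1, abs_of_nonpos hw, neg_neg, ← ht]
    rw [abs_of_nonpos (by linarith)] at h1 h2
    linarith

/-- The left side tends to one at infinity while `v^{-θ}` decays; a small exponential pays for the
difference. The bound starts from `1 - e^{-v} ≥ v/(1+v)`. -/
theorem one_sub_exp_neg_rpow_le {ε θ v : ℝ} (hε : 0 < ε) (hθ0 : 0 < θ) (hθ1 : θ < 1) (hv : 0 < v) :
    (1 - Real.exp (-v)) ^ (-θ) ≤ (1 + 1 / ε) * Real.exp (ε * v) * v ^ (-θ) := by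
  have h1 : v / (1 + v) ≤ 1 - Real.exp (-v) := by
    have h2 : Real.exp (-v) ≤ 1 / (1 + v) := by
      rw [Real.exp_neg, ← one_div]
      gcongr
      linarith [Real.add_one_le_exp v]
    have h3 : v / (1 + v) = 1 - 1 / (1 + v) := by field_simp; ring
    linarith
  calc (1 - Real.exp (-v)) ^ (-θ) ≤ (v / (1 + v)) ^ (-θ) :=
        Real.rpow_le_rpow_of_nonpos (by positivity) h1 (by linarith)
    _ = (1 + v) ^ θ * v ^ (-θ) := by
        rw [Real.div_rpow hv.le (by positivity), Real.rpow_neg (x := 1 + v) (by positivity),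
          div_inv_eq_mul, mul_comm]
    _ ≤ (1 + v) * v ^ (-θ) := by
        gcongr
        calc (1 + v) ^ θ ≤ (1 + v) ^ (1 : ℝ) :=
              Real.rpow_le_rpow_of_exponent_le (by linarith) hθ1.le
          _ = 1 + v := Real.rpow_one _
    _ ≤ _ := by
        gcongr
        have h4 := Real.add_one_le_exp (ε * v)
        have h5 : 1 ≤ Real.exp (ε * v) := Real.one_le_exp (by positivity)
        have h6 : v ≤ 1 / ε * Real.exp (ε * v) := by
          rw [one_div_mul_eq_div, le_div_iff₀ hε]; linarith
        linarith

/-- Spherical averages of the Riesz kernel in logarithmic coordinates. -/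
theorem lintegral_sphere_riesz_le {n : ℕ} {s α β θ : ℝ} (hα : 0 < α) (hβ : 0 < β)
    (hαβ : α + β = n - s) (hθ0 : 0 < θ) (hθ1 : θ < 1) (hsθ : 1 - s ≤ θ) :
    ∃ A : ℝ, 0 < A ∧ ∀ (x y : ℝ) (z : EuclideanSpace ℝ (Fin n)), ‖z‖ = Real.exp y →
      ∫⁻ ω, ‖Real.exp x • (ω : EuclideanSpace ℝ (Fin n)) - z‖ₑ ^ (s - n)
        ∂(volume : Measure (EuclideanSpace ℝ (Fin n))).toSphere
      ≤ ENNReal.ofReal (A * Real.exp ((s - n) * y - α * (x - y)))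
          * expRieszKernel (min α β / 2) θ (x - y) := by
  obtain ⟨C, hC, hcap⟩ := lintegral_sphere_dist_rpow_le n hθ0
  set ε := min α β / 2 with hε
  have hε0 : 0 < ε := by have := lt_min hα hβ; positivity
  have hεα : 2 * ε ≤ α := by have := min_le_left α β; linarith
  have hεβ : 2 * ε ≤ β := by have := min_le_right α β; linarith
  set K : ℝ := 3 ^ ((n : ℝ) - s) * 3 ^ (s - 1 + θ) with hK
  have hK0 : 0 < K := by positivity
  refine ⟨K * C * (1 + 1 / ε), by positivity, fun x y z hz => ?_⟩
  have hn : n ≠ 0 := by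
    rintro rfl
    rw [Subsingleton.elim z 0, norm_zero] at hz
    exact (Real.exp_pos y).ne hz
  have hn1 : ((n - 1 : ℕ) : ℝ) = n - 1 := by
    rw [Nat.cast_sub (Nat.one_le_iff_ne_zero.2 hn), Nat.cast_one]
  set w := x - y with hw
  by_cases hw0 : w = 0
  -- On the diagonal the kernel on the right takes the value `∞`.
  · rw [hw0, expRieszKernel, enorm_zero, ENNReal.zero_rpow_of_neg (by linarith), ENNReal.mul_top,
      ENNReal.mul_top]
    · exact le_top
    · rw [Ne, ENNReal.ofReal_eq_zero, not_le]; positivity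
    · rw [Ne, ENNReal.ofReal_eq_zero, not_le]; positivity
  have hwp : 0 < |w| := abs_pos.2 hw0
  set e := Real.exp (-y) • z with he
  have he1 : ‖e‖ = 1 := by
    rw [he, norm_smul, Real.norm_of_nonneg (Real.exp_pos _).le, hz, ← Real.exp_add]; simp
  have hze : z = Real.exp y • e := by
    rw [he, smul_smul, ← Real.exp_add]; simp
  set δ := 1 - Real.exp (-|w|) with hδ
  have hδ0 : 0 < δ := by
    have : Real.exp (-|w|) < 1 := Real.exp_lt_one_iff.2 (by linarith)
    linarith
  have hδ1 : δ ≤ 1 := by have := Real.exp_pos (-|w|); linarith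
  -- The decay `2ε|w|` comes from `max(e^w, 1)^{s-n}`: `2ε ≤ β` is used for `w ≥ 0` and `2ε ≤ α` for
  -- `w ≤ 0`. One `ε` pays for replacing `δ^{-θ}` by `|w|^{-θ}`; the other stays in the kernel.
  set P := Real.exp ((s - n) * y) * Real.exp (-α * w - 2 * ε * |w|) * K with hP
  have hP0 : 0 < P := by positivity
  have hpt : ∀ ω : Metric.sphere (0 : EuclideanSpace ℝ (Fin n)) 1,
      ‖Real.exp x • (ω : EuclideanSpace ℝ (Fin n)) - z‖ₑ ^ (s - n) ≤ ENNReal.ofReal P *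
      ENNReal.ofReal ((δ + ‖(ω : EuclideanSpace ℝ (Fin n)) - e‖) ^ (-(((n - 1 : ℕ) : ℝ) + θ))) := by
    intro ω
    have hω1 : ‖(ω : EuclideanSpace ℝ (Fin n))‖ = 1 := by simp
    have hgeo := three_mul_norm_smul_sub_ge hω1 he1 w
    rw [← hδ] at hgeo
    set D := δ + ‖(ω : EuclideanSpace ℝ (Fin n)) - e‖ with hD
    have hD0 : 0 < D := by positivity
    have hD3 : D ≤ 3 := by
      have := norm_sub_le (ω : EuclideanSpace ℝ (Fin n)) e
      rw [hω1, he1] at this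
      linarith
    have hM : max (Real.exp w) 1 = Real.exp (max w 0) := by
      rw [Real.exp_monotone.map_max, Real.exp_zero]
    rw [hM] at hgeo
    have hX : ‖Real.exp x • (ω : EuclideanSpace ℝ (Fin n)) - z‖
        = Real.exp y * ‖Real.exp w • (ω : EuclideanSpace ℝ (Fin n)) - e‖ := by
      have hxy : x = y + w := by rw [hw]; ring
      calc _ = ‖Real.exp y • (Real.exp w • (ω : EuclideanSpace ℝ (Fin n)) - e)‖ := by
            rw [smul_sub, smul_smul, ← Real.exp_add, ← hze, ← hxy]
        _ = _ := by rw [norm_smul, Real.norm_of_nonneg (Real.exp_pos y).le]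
    have hX1 : Real.exp y * (Real.exp (max w 0) * D * 3⁻¹) ≤
        ‖Real.exp x • (ω : EuclideanSpace ℝ (Fin n)) - z‖ := by
      rw [hX]
      gcongr
      linarith
    have hX0 : 0 < ‖Real.exp x • (ω : EuclideanSpace ℝ (Fin n)) - z‖ :=
      lt_of_lt_of_le (by positivity) hX1
    rw [← ofReal_norm, ENNReal.ofReal_rpow_of_pos hX0, ← ENNReal.ofReal_mul hP0.le]
    refine ENNReal.ofReal_le_ofReal ?_
    have hsn : s - n < 0 := by linarith
    calc _ ≤ (Real.exp y * (Real.exp (max w 0) * D * 3⁻¹)) ^ (s - n) :=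
          Real.rpow_le_rpow_of_nonpos (by positivity) hX1 hsn.le
      _ = Real.exp ((s - n) * y) * Real.exp ((s - n) * max w 0) * 3 ^ ((n : ℝ) - s) * D ^ (s - n) := by
          rw [Real.mul_rpow (by positivity) (by positivity), Real.mul_rpow (by positivity)
            (by positivity), Real.mul_rpow (by positivity) (by positivity),
            Real.inv_rpow (by positivity), ← Real.rpow_neg (by positivity), neg_sub,
            ← Real.exp_mul, ← Real.exp_mul, mul_comm y, mul_comm (max w 0)]
          ring
      _ ≤ Real.exp ((s - n) * y) * Real.exp (-α * w - 2 * ε * |w|) * 3 ^ ((n : ℝ) - s) *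
            (3 ^ (s - 1 + θ) * D ^ (-(((n - 1 : ℕ) : ℝ) + θ))) := by
          gcongr ?_ * Real.exp ?_ * _ * ?_
          · rcases le_total 0 w with h | h
            · rw [max_eq_left h, abs_of_nonneg h]
              nlinarith
            · rw [max_eq_right h, abs_of_nonpos h]
              nlinarith
          -- Here `θ ≥ 1 - s` enters: the surplus power `D^{s-1+θ}` has nonnegative exponent and `D
          -- ≤ 3`.
          · have : s - n = (s - 1 + θ) + (-(((n - 1 : ℕ) : ℝ) + θ)) := by rw [hn1]; ring
            rw [this, Real.rpow_add hD0]
            gcongr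
            linarith
      _ = _ := by rw [hP, hK]; ring
  calc _ ≤ ∫⁻ ω, ENNReal.ofReal P * ENNReal.ofReal
        ((δ + ‖(ω : EuclideanSpace ℝ (Fin n)) - e‖) ^ (-(((n - 1 : ℕ) : ℝ) + θ)))
        ∂(volume : Measure (EuclideanSpace ℝ (Fin n))).toSphere := lintegral_mono hpt
    _ ≤ ENNReal.ofReal P * ENNReal.ofReal (C * δ ^ (-θ)) := by
        rw [lintegral_const_mul' _ _ ENNReal.ofReal_ne_top]
        exact mul_le_mul' le_rfl (hcap e he1 δ hδ0)
    _ ≤ _ := by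
        rw [expRieszKernel, Real.enorm_eq_ofReal_abs, ENNReal.ofReal_rpow_of_pos hwp,
          ← ENNReal.ofReal_mul hP0.le, ← ENNReal.ofReal_mul (by positivity),
          ← ENNReal.ofReal_mul (by positivity)]
        refine ENNReal.ofReal_le_ofReal ?_
        calc P * (C * δ ^ (-θ)) ≤ P * (C * ((1 + 1 / ε) * Real.exp (ε * |w|) * |w| ^ (-θ))) := by
              gcongr
              exact one_sub_exp_neg_rpow_le hε0 hθ0 hθ1 hwp
          _ = _ := by
              have : Real.exp ((s - n) * y) * Real.exp (-α * w - 2 * ε * |w|) * Real.exp (ε * |w|)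
                  = Real.exp ((s - n) * y - α * w) * Real.exp (-(ε * |w|)) := by
                rw [← Real.exp_add, ← Real.exp_add, ← Real.exp_add]; congr 1; ring
              rw [hP]
              linear_combination (K * C * (1 + 1 / ε) * |w| ^ (-θ)) * this

/-! ### Logarithmic polar coordinates. -/

/-- Integration in logarithmic polar coordinates. -/
theorem lintegral_eq_lintegral_log_polar {n : ℕ} (hn : n ≠ 0)
    (g : EuclideanSpace ℝ (Fin n) → ℝ≥0∞) (hg : Measurable g) :
    ∫⁻ x, g x = ∫⁻ t : ℝ, ENNReal.ofReal (Real.exp (n * t)) *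
      ∫⁻ ω, g (Real.exp t • (ω : EuclideanSpace ℝ (Fin n)))
        ∂(volume : Measure (EuclideanSpace ℝ (Fin n))).toSphere := by
  have : NeZero n := ⟨hn⟩
  have h0 : ∫⁻ x, g x = ∫⁻ x : ({0}ᶜ : Set (EuclideanSpace ℝ (Fin n))), g x ∂((volume : Measure (EuclideanSpace ℝ (Fin n))).comap (↑)) := by
    rw [lintegral_subtype_comap (measurableSet_singleton _).compl, restrict_compl_singleton]
  have hmp := (volume : Measure (EuclideanSpace ℝ (Fin n))).measurePreserving_homeomorphUnitSphereProd
  have h1 := hmp.symm (homeomorphUnitSphereProd (EuclideanSpace ℝ (Fin n))).toMeasurableEquiv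
  have h2 := h1.lintegral_comp_emb (MeasurableEquiv.measurableEmbedding _)
    (fun x : ({0}ᶜ : Set (EuclideanSpace ℝ (Fin n))) => g x)
  rw [h0, ← h2, lintegral_prod_symm' _ (by
    refine hg.comp (measurable_subtype_coe.comp (MeasurableEquiv.measurable _)))]
  rw [finrank_euclideanSpace_fin, Measure.volumeIoiPow]
  have hG : Measurable (fun r : ℝ => ∫⁻ ω, g (r • (ω : EuclideanSpace ℝ (Fin n))) ∂(volume : Measure (EuclideanSpace ℝ (Fin n))).toSphere) := by
    apply Measurable.lintegral_prod_right' (f := fun z : ℝ × Metric.sphere (0 : EuclideanSpace ℝ (Fin n)) 1 =>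
      g (z.1 • (z.2 : EuclideanSpace ℝ (Fin n))))
    fun_prop
  have h4 := lintegral_withDensity_eq_lintegral_mul (Measure.comap Subtype.val volume)
    (f := fun r : Set.Ioi (0 : ℝ) => ENNReal.ofReal ((r : ℝ) ^ (n - 1))) (by fun_prop)
    (g := fun r : Set.Ioi (0 : ℝ) => ∫⁻ ω, g ((r : ℝ) • (ω : EuclideanSpace ℝ (Fin n)))
      ∂(volume : Measure (EuclideanSpace ℝ (Fin n))).toSphere) (hG.comp measurable_subtype_coe)
  refine Eq.trans h4 ?_
  simp only [Pi.mul_apply]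
  rw [lintegral_subtype_comap measurableSet_Ioi (fun r : ℝ => ENNReal.ofReal (r ^ (n - 1)) *
    ∫⁻ ω, g (r • (ω : EuclideanSpace ℝ (Fin n))) ∂(volume : Measure (EuclideanSpace ℝ (Fin n))).toSphere)]
  have h3 := lintegral_image_eq_lintegral_abs_deriv_mul (s := Set.univ) (f := Real.exp)
    (f' := Real.exp) MeasurableSet.univ (fun x _ => (Real.hasDerivAt_exp x).hasDerivWithinAt)
    Real.exp_injective.injOn (fun r : ℝ => ENNReal.ofReal (r ^ (n - 1)) *
    ∫⁻ ω, g (r • (ω : EuclideanSpace ℝ (Fin n))) ∂(volume : Measure (EuclideanSpace ℝ (Fin n))).toSphere)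
  rw [Set.image_univ, Real.range_exp, setLIntegral_univ] at h3
  rw [h3]
  refine lintegral_congr fun t => ?_
  rw [← mul_assoc, ← ENNReal.ofReal_mul (abs_nonneg _), abs_of_pos (Real.exp_pos t), ← pow_succ',
    Nat.sub_add_cancel (Nat.one_le_iff_ne_zero.2 hn), Real.exp_nat_mul]

/-- Tonelli for null sets in polar coordinates; the exceptional set is enlarged to a measurable null
set so that its indicator can be integrated. -/
theorem ae_log_polar {n : ℕ} (hn : n ≠ 0) {P : EuclideanSpace ℝ (Fin n) → Prop}
    (hP : ∀ᵐ x, P x) :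
    ∀ᵐ t : ℝ, ∀ᵐ ω : Metric.sphere (0 : EuclideanSpace ℝ (Fin n)) 1
      ∂(volume : Measure (EuclideanSpace ℝ (Fin n))).toSphere,
      P (Real.exp t • (ω : EuclideanSpace ℝ (Fin n))) := by
  set N := toMeasurable volume {x | ¬ P x} with hN
  have hNm : MeasurableSet N := measurableSet_toMeasurable _ _
  have hN0 : volume N = 0 := by rw [hN, measure_toMeasurable]; exact hP
  rw [← lintegral_indicator_one hNm, lintegral_eq_lintegral_log_polar hn _
    (measurable_one.indicator hNm)] at hN0
  have hmeas : Measurable (fun z : ℝ × Metric.sphere (0 : EuclideanSpace ℝ (Fin n)) 1 =>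
      N.indicator (1 : EuclideanSpace ℝ (Fin n) → ℝ≥0∞)
        (Real.exp z.1 • (z.2 : EuclideanSpace ℝ (Fin n)))) :=
    (measurable_one.indicator hNm).comp (by fun_prop)
  erw [lintegral_eq_zero_iff ((by fun_prop : Measurable fun t : ℝ =>
    ENNReal.ofReal (Real.exp (n * t))).mul (hmeas.lintegral_prod_right' (ν := (volume : Measure (EuclideanSpace ℝ (Fin n))).toSphere)))] at hN0
  filter_upwards [hN0] with t ht
  simp only [Pi.mul_apply, Pi.zero_apply, mul_eq_zero] at ht
  have ht' := ht.resolve_left (by rw [ENNReal.ofReal_eq_zero, not_le]; positivity)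
  have ht2 := (lintegral_eq_zero_iff (f := fun ω : Metric.sphere (0 : EuclideanSpace ℝ (Fin n)) 1 =>
    N.indicator (1 : EuclideanSpace ℝ (Fin n) → ℝ≥0∞)
      (Real.exp t • (ω : EuclideanSpace ℝ (Fin n))))
    ((measurable_one.indicator hNm).comp (by fun_prop))).1 ht'
  filter_upwards [ht2] with ω hω
  by_contra hcon
  have : Real.exp t • (ω : EuclideanSpace ℝ (Fin n)) ∈ N := subset_toMeasurable _ _ hcon
  simp [this] at hω

theorem ae_of_ae_log_norm {n : ℕ} (hn : n ≠ 0) {P : ℝ → Prop} (hP : ∀ᵐ t, P t) :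
    ∀ᵐ x : EuclideanSpace ℝ (Fin n), P (Real.log ‖x‖) := by
  set N := toMeasurable volume {t | ¬ P t} with hN
  have hNm : MeasurableSet N := measurableSet_toMeasurable _ _
  have hN0 : volume N = 0 := by rw [hN, measure_toMeasurable]; exact hP
  set M : Set (EuclideanSpace ℝ (Fin n)) := {x | Real.log ‖x‖ ∈ N} with hM
  have hMm : MeasurableSet M :=
    (Real.measurable_log.comp measurable_norm) hNm
  have : volume M = 0 := by
    rw [← lintegral_indicator_one hMm, lintegral_eq_lintegral_log_polar hn _
      (measurable_one.indicator hMm), lintegral_congr_ae (g := fun _ => 0), lintegral_zero]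
    have hN' : ∀ᵐ t, t ∉ N := by rw [ae_iff]; simpa using hN0
    filter_upwards [hN'] with t ht
    have : ∀ ω : Metric.sphere (0 : EuclideanSpace ℝ (Fin n)) 1,
        Real.exp t • (ω : EuclideanSpace ℝ (Fin n)) ∉ M := by
      intro ω
      show ¬ (Real.log _ ∈ N)
      rw [norm_smul, Real.norm_of_nonneg (Real.exp_pos t).le]
      simpa using ht
    simp [this]
  rw [ae_iff]
  refine measure_mono_null (fun x hx => ?_) this
  exact subset_toMeasurable _ _ hx

/-! ### From Bessel to Riesz potentials, and their spherical averages. -/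

/-- The Bessel kernel is dominated by the Riesz kernel. -/
theorem enorm_besselKernel_le {n : ℕ} {s : ℝ} (hs : 0 < s) (hsn : s < n) :
    ∃ C : ℝ, 0 < C ∧ ∀ x : EuclideanSpace ℝ (Fin n),
      ‖besselKernel n s x‖ₑ ≤ ENNReal.ofReal C * ‖x‖ₑ ^ (s - n) := by
  set a : ℝ := (n - s) / 2 with ha
  have ha0 : 0 < a := by have := sub_pos.2 hsn; positivity
  set B : ℝ := ((2 * Real.sqrt Real.pi) ^ n)⁻¹ / Real.Gamma (s / 2) with hB
  have hB0 : 0 < B := by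
    have := Real.Gamma_pos_of_pos (half_pos hs)
    have := Real.pi_pos
    positivity
  have hΓ := Real.Gamma_pos_of_pos ha0
  refine ⟨B * (4 ^ a * Real.Gamma a), by positivity, fun x => ?_⟩
  by_cases hx : x = 0
  · rw [hx, enorm_zero, ENNReal.zero_rpow_of_neg (by linarith), ENNReal.mul_top]
    · exact le_top
    · rw [Ne, ENNReal.ofReal_eq_zero, not_le]; positivity
  have hx0 : 0 < ‖x‖ := norm_pos_iff.2 hx
  set r := ‖x‖ ^ 2 / 4 with hr
  have hr0 : 0 < r := by positivity
  set h : ℝ → ℝ := fun y => y ^ (a - 1) * Real.exp (-(r * y)) with hh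
  -- `H` is the integrand without `e^{-t}`, written as the pullback of a Gamma integrand under `t ↦
  -- 1/t`.
  set H : ℝ → ℝ := fun t => (|(-1 : ℝ)| * t ^ ((-1 : ℝ) - 1)) • h (t ^ (-1 : ℝ)) with hH
  have hI : ∫ t in Set.Ioi (0 : ℝ), H t = (1 / r) ^ a * Real.Gamma a := by
    rw [hH, integral_comp_rpow_Ioi h (by norm_num), hh, Real.integral_rpow_mul_exp_neg_mul_Ioi ha0 hr0]
  have hint : IntegrableOn h (Set.Ioi 0) := by
    -- A non-integrable function has integral zero by convention, whereas the Gamma integral is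
    -- positive.
    by_contra hcon
    have h1 := Real.integral_rpow_mul_exp_neg_mul_Ioi ha0 hr0
    rw [integral_undef hcon] at h1
    have : 0 < (1 / r) ^ a * Real.Gamma a := by positivity
    linarith
  have hHint : IntegrableOn H (Set.Ioi 0) := (integrableOn_Ioi_comp_rpow_iff h (by norm_num)).2 hint
  have hle : ∫ t in Set.Ioi (0 : ℝ), Real.exp (-t) * Real.exp (-‖x‖ ^ 2 / (4 * t)) *
      t ^ ((s - n) / 2) / t ≤ (1 / r) ^ a * Real.Gamma a := by
    rw [← hI]
    refine integral_mono_of_nonneg ?_ hHint ?_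
    · filter_upwards [ae_restrict_mem measurableSet_Ioi] with t ht
      have : 0 < t := ht
      positivity
    · filter_upwards [ae_restrict_mem measurableSet_Ioi] with t ht
      have ht0 : 0 < t := ht
      have e1 : H t = Real.exp (-‖x‖ ^ 2 / (4 * t)) * t ^ ((s - n) / 2) / t := by
        simp only [hH, hh, smul_eq_mul, abs_neg, abs_one, one_mul]
        rw [← Real.rpow_mul ht0.le, ← mul_assoc, ← Real.rpow_add ht0,
          div_eq_mul_inv _ t, mul_assoc, ← Real.rpow_neg_one t, ← Real.rpow_add ht0, mul_comm]
        congr 1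
        · congr 1
          rw [Real.rpow_neg_one, hr]; field_simp
        · congr 1
          rw [ha]; ring
      rw [e1, mul_assoc, mul_div_assoc]
      refine mul_le_of_le_one_left (by positivity) ?_
      rw [Real.exp_le_one_iff]; linarith
  have hnn : 0 ≤ ∫ t in Set.Ioi (0 : ℝ), Real.exp (-t) * Real.exp (-‖x‖ ^ 2 / (4 * t)) *
      t ^ ((s - n) / 2) / t := by
    refine setIntegral_nonneg measurableSet_Ioi fun t ht => ?_
    have : 0 < t := ht
    positivity
  have hbk : besselKernel n s x = B * ∫ t in Set.Ioi (0 : ℝ), Real.exp (-t) *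
      Real.exp (-‖x‖ ^ 2 / (4 * t)) * t ^ ((s - n) / 2) / t := rfl
  rw [Real.enorm_eq_ofReal_abs, hbk, abs_of_nonneg (mul_nonneg hB0.le hnn),
    ← ofReal_norm, ENNReal.ofReal_rpow_of_pos hx0, ← ENNReal.ofReal_mul (by positivity)]
  refine ENNReal.ofReal_le_ofReal ?_
  rw [mul_assoc]
  refine mul_le_mul_of_nonneg_left (hle.trans (le_of_eq ?_)) hB0.le
  have : (1 / r) ^ a = 4 ^ a * ‖x‖ ^ (s - n) := by
    rw [hr, one_div_div, Real.div_rpow (by positivity) (by positivity), ← Real.rpow_natCast,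
      ← Real.rpow_mul hx0.le, div_eq_mul_inv, ← Real.rpow_neg hx0.le]
    congr 2
    rw [ha]; push_cast; ring
  rw [this]; ring

theorem measurable_lintegral_riesz {n : ℕ} (r : ℝ) {G : EuclideanSpace ℝ (Fin n) → ℝ≥0∞}
    (hG : Measurable G) :
    Measurable fun x : EuclideanSpace ℝ (Fin n) => ∫⁻ y, ‖x - y‖ₑ ^ r * G y := by
  apply Measurable.lintegral_prod_right' (f := fun z : EuclideanSpace ℝ (Fin n) ×
    EuclideanSpace ℝ (Fin n) => ‖z.1 - z.2‖ₑ ^ r * G z.2)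
  fun_prop

/-- Spherical averages of Riesz potentials are controlled by a convolution on the line. -/
theorem lintegral_sphere_rieszPotential_le {n : ℕ} {s p α θ : ℝ} (hp : 1 < p) (hα : 0 < α)
    (hαs : α = n / p - s) (hn : n ≠ 0) (hθ0 : 0 < θ) (hθ1 : θ < 1) (hsθ : 1 - s ≤ θ) :
    ∃ K : ℝ, 0 < K ∧ ∀ G : EuclideanSpace ℝ (Fin n) → ℝ≥0∞, Measurable G → ∀ t : ℝ,
      ENNReal.ofReal (Real.exp (α * t)) *
        ∫⁻ ω, (∫⁻ y, ‖Real.exp t • (ω : EuclideanSpace ℝ (Fin n)) - y‖ₑ ^ (s - n) * G y)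
          ∂(volume : Measure (EuclideanSpace ℝ (Fin n))).toSphere
      ≤ ENNReal.ofReal K * ∫⁻ τ, expRieszKernel (min α (n - n / p) / 2) θ (t - τ) *
          (ENNReal.ofReal (Real.exp (n / p * τ)) *
            (∫⁻ ω, G (Real.exp τ • (ω : EuclideanSpace ℝ (Fin n))) ^ p
              ∂(volume : Measure (EuclideanSpace ℝ (Fin n))).toSphere) ^ (1 / p)) := by
  have hp0 : 0 < p := by linarith
  have hn0 : (0 : ℝ) < n := by exact_mod_cast Nat.pos_of_ne_zero hn
  have hβ : (0 : ℝ) < n - n / p := by have := div_lt_self hn0 hp; linarith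
  obtain ⟨A, hA, hker⟩ := lintegral_sphere_riesz_le (n := n) (s := s) hα hβ
    (by rw [hαs]; ring) hθ0 hθ1 hsθ
  set σ := (volume : Measure (EuclideanSpace ℝ (Fin n))).toSphere with hσ
  set κ := expRieszKernel (min α (n - n / p) / 2) θ with hκ
  have hκm : Measurable κ := measurable_expRieszKernel _ _
  set T : ℝ≥0∞ := σ Set.univ ^ (1 - 1 / p) with hT
  have h1p : 0 ≤ 1 - 1 / p := by
    have : 1 / p < 1 := by rw [div_lt_one hp0]; exact hp
    linarith
  have hTtop : T ≠ ⊤ := ENNReal.rpow_ne_top_of_nonneg h1p (measure_ne_top _ _)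
  refine ⟨A * (T.toReal + 1), by positivity, fun G hG t => ?_⟩
  have hTle : T ≤ ENNReal.ofReal (T.toReal + 1) := by
    rw [ENNReal.le_ofReal_iff_toReal_le hTtop (by positivity)]; linarith
  set F : ℝ → ℝ≥0∞ := fun τ =>
    (∫⁻ ω, G (Real.exp τ • (ω : EuclideanSpace ℝ (Fin n))) ^ p ∂σ) ^ (1 / p) with hF
  -- The kernel bound depends on `z` only through its norm, so `G` enters only through its spherical
  -- mean, which Hölder turns into an `L^p` mean.
  have hholder : ∀ τ : ℝ, ∫⁻ η, G (Real.exp τ • (η : EuclideanSpace ℝ (Fin n))) ∂σ ≤ T * F τ := by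
    intro τ
    have hh := ENNReal.lintegral_mul_le_Lp_mul_Lq σ (Real.HolderConjugate.conjExponent hp).symm
      (f := fun _ => 1) (g := fun η => G (Real.exp τ • (η : EuclideanSpace ℝ (Fin n))))
      (by fun_prop) (by fun_prop)
    have hinv : 1 / p.conjExponent = 1 - 1 / p := by
      rw [Real.conjExponent]; field_simp
    simpa [hinv, hT, hF] using hh
  have hJm : Measurable fun y : EuclideanSpace ℝ (Fin n) =>
      ∫⁻ ω, ‖Real.exp t • (ω : EuclideanSpace ℝ (Fin n)) - y‖ₑ ^ (s - n) ∂σ := by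
    apply Measurable.lintegral_prod_right' (f := fun z : EuclideanSpace ℝ (Fin n) ×
      Metric.sphere (0 : EuclideanSpace ℝ (Fin n)) 1 =>
      ‖Real.exp t • (z.2 : EuclideanSpace ℝ (Fin n)) - z.1‖ₑ ^ (s - n))
    fun_prop
  have hswap : ∫⁻ ω, (∫⁻ y, ‖Real.exp t • (ω : EuclideanSpace ℝ (Fin n)) - y‖ₑ ^ (s - n) * G y) ∂σ
      = ∫⁻ y, (∫⁻ ω, ‖Real.exp t • (ω : EuclideanSpace ℝ (Fin n)) - y‖ₑ ^ (s - n) ∂σ) * G y := by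
    rw [lintegral_lintegral_swap (by fun_prop)]
    refine lintegral_congr fun y => ?_
    rw [lintegral_mul_const _ (by fun_prop)]
  rw [hswap, lintegral_eq_lintegral_log_polar hn (fun y => (∫⁻ ω, ‖Real.exp t •
    (ω : EuclideanSpace ℝ (Fin n)) - y‖ₑ ^ (s - n) ∂σ) * G y) (hJm.mul hG),
    ← lintegral_const_mul' _ _ ENNReal.ofReal_ne_top,
    ← lintegral_const_mul' _ _ ENNReal.ofReal_ne_top]
  refine lintegral_mono fun τ => ?_
  have hGτ : Measurable fun η : Metric.sphere (0 : EuclideanSpace ℝ (Fin n)) 1 =>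
    G (Real.exp τ • (η : EuclideanSpace ℝ (Fin n))) := by fun_prop
  set Q : ℝ≥0∞ := ENNReal.ofReal (A * Real.exp ((s - n) * τ - α * (t - τ))) * κ (t - τ) with hQ
  calc _ ≤ ENNReal.ofReal (Real.exp (α * t)) * (ENNReal.ofReal (Real.exp (n * τ)) *
        ∫⁻ η, Q * G (Real.exp τ • (η : EuclideanSpace ℝ (Fin n))) ∂σ) := by
        refine mul_le_mul' le_rfl (mul_le_mul' le_rfl (lintegral_mono fun η => ?_))
        refine mul_le_mul' (hker t τ _ ?_) le_rfl
        rw [norm_smul, Real.norm_of_nonneg (Real.exp_pos τ).le]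
        simp
    _ ≤ ENNReal.ofReal (Real.exp (α * t)) * (ENNReal.ofReal (Real.exp (n * τ)) *
        (Q * (ENNReal.ofReal (T.toReal + 1) * F τ))) := by
        rw [lintegral_const_mul _ hGτ]
        gcongr
        exact (hholder τ).trans (by gcongr)
    _ = (ENNReal.ofReal (Real.exp (α * t)) * ENNReal.ofReal (Real.exp (n * τ)) *
          ENNReal.ofReal (A * Real.exp ((s - n) * τ - α * (t - τ))) *
          ENNReal.ofReal (T.toReal + 1)) * (κ (t - τ) * F τ) := by rw [hQ]; ring
    _ = (ENNReal.ofReal (A * (T.toReal + 1)) * ENNReal.ofReal (Real.exp (n / p * τ))) *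
          (κ (t - τ) * F τ) := by
        congr 1
        rw [← ENNReal.ofReal_mul (by positivity), ← ENNReal.ofReal_mul (by positivity),
          ← ENNReal.ofReal_mul (by positivity), ← ENNReal.ofReal_mul (by positivity)]
        congr 1
        have : Real.exp (α * t) * Real.exp (n * τ) * Real.exp ((s - n) * τ - α * (t - τ))
            = Real.exp (n / p * τ) := by
          rw [← Real.exp_add, ← Real.exp_add]; congr 1; rw [hαs]; ring
        linear_combination (A * (T.toReal + 1)) * this
    _ = _ := by ring

theorem lintegral_rpow_eq_log_polar {n : ℕ} (hn : n ≠ 0) {p : ℝ} (hp : 0 < p)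
    {G : EuclideanSpace ℝ (Fin n) → ℝ≥0∞} (hG : Measurable G) :
    ∫⁻ τ, (ENNReal.ofReal (Real.exp (n / p * τ)) *
      (∫⁻ ω, G (Real.exp τ • (ω : EuclideanSpace ℝ (Fin n))) ^ p
        ∂(volume : Measure (EuclideanSpace ℝ (Fin n))).toSphere) ^ (1 / p)) ^ p
      = ∫⁻ x, G x ^ p := by
  rw [lintegral_eq_lintegral_log_polar hn _ (hG.pow_const p)]
  refine lintegral_congr fun τ => ?_
  rw [ENNReal.mul_rpow_of_nonneg _ _ hp.le, ← ENNReal.rpow_mul, one_div_mul_cancel hp.ne',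
    ENNReal.rpow_one, ENNReal.ofReal_rpow_of_pos (Real.exp_pos _), ← Real.exp_mul]
  have : n / p * τ * p = n * τ := by field_simp
  rw [this]

/-- The weight contributes `e^{ct}` and the volume element `e^{nt}`, which together make `e^{αqt}`.
-/
theorem lintegral_weight_log_norm_eq {n : ℕ} (hn : n ≠ 0) {c q α : ℝ} (hq : 0 < q)
    (hα : α * q = n + c) {V : ℝ → ℝ≥0∞} (hV : Measurable V) :
    ∫⁻ x : EuclideanSpace ℝ (Fin n), (ENNReal.ofReal (‖x‖ ^ (c / q)) * V (Real.log ‖x‖)) ^ q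
      = (volume : Measure (EuclideanSpace ℝ (Fin n))).toSphere Set.univ *
        ∫⁻ t, (ENNReal.ofReal (Real.exp (α * t)) * V t) ^ q := by
  rw [lintegral_eq_lintegral_log_polar hn _ (by
      have := hV.comp (Real.measurable_log.comp
        (measurable_norm (α := EuclideanSpace ℝ (Fin n))))
      refine Measurable.pow_const (Measurable.mul (by fun_prop) this) q),
    ← lintegral_const_mul' _ _ (measure_ne_top _ _)]
  refine lintegral_congr fun t => ?_
  have h : ∀ ω : Metric.sphere (0 : EuclideanSpace ℝ (Fin n)) 1,
      ‖Real.exp t • (ω : EuclideanSpace ℝ (Fin n))‖ = Real.exp t := by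
    intro ω
    rw [norm_smul, Real.norm_of_nonneg (Real.exp_pos t).le]
    simp
  simp_rw [h]
  rw [lintegral_const, Real.log_exp, mul_comm _ (Measure.toSphere _ _), mul_left_comm]
  congr 1
  rw [ENNReal.mul_rpow_of_nonneg _ _ hq.le, ENNReal.mul_rpow_of_nonneg _ _ hq.le, ← mul_assoc]
  congr 1
  rw [ENNReal.ofReal_rpow_of_pos (Real.exp_pos _), ENNReal.ofReal_rpow_of_pos (by positivity),
    ← ENNReal.ofReal_mul (Real.exp_pos _).le, ← Real.exp_mul, ← Real.exp_mul, ← Real.exp_mul,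
    ← Real.exp_add]
  congr 2
  have : t * (c / q) * q = c * t := by field_simp
  rw [this, mul_right_comm, hα]; ring

/-! ### Use of radial symmetry and proof of the embedding. -/

/-- A radial function is bounded by the spherical averages of any bound. -/
theorem IsRadial.ae_enorm_le_sphere_average {𝕜 : Type*} [RCLike 𝕜] {n : ℕ} (hn : n ≠ 0)
    {u : EuclideanSpace ℝ (Fin n) → 𝕜} (hu : IsRadial u)
    {W : EuclideanSpace ℝ (Fin n) → ℝ≥0∞} (hW : ∀ᵐ x, ‖u x‖ₑ ≤ W x) :
    ∀ᵐ x : EuclideanSpace ℝ (Fin n), ‖u x‖ₑ ≤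
      ((volume : Measure (EuclideanSpace ℝ (Fin n))).toSphere Set.univ)⁻¹ *
        ∫⁻ ω, W (Real.exp (Real.log ‖x‖) • (ω : EuclideanSpace ℝ (Fin n)))
          ∂(volume : Measure (EuclideanSpace ℝ (Fin n))).toSphere := by
  have : NeZero n := ⟨hn⟩
  obtain ⟨u₀, hu₀⟩ := hu
  set σ := (volume : Measure (EuclideanSpace ℝ (Fin n))).toSphere with hσ
  have hσ0 : σ Set.univ ≠ 0 := by
    rw [Ne, Measure.measure_univ_eq_zero]
    exact Measure.toSphere_ne_zero _
  have h1 : ∀ᵐ x, ‖u₀ ‖x‖‖ₑ ≤ W x := by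
    filter_upwards [hu₀, hW] with x hx1 hx2
    rwa [← hx1]
  have h2 : ∀ᵐ t : ℝ, ‖u₀ (Real.exp t)‖ₑ ≤ (σ Set.univ)⁻¹ *
      ∫⁻ ω, W (Real.exp t • (ω : EuclideanSpace ℝ (Fin n))) ∂σ := by
    filter_upwards [ae_log_polar hn h1] with t ht
    -- For fixed `t` the left integrand is constant on the sphere, so no measurability of `u₀` is
    -- needed.
    have h3 : ∫⁻ _ω : Metric.sphere (0 : EuclideanSpace ℝ (Fin n)) 1, ‖u₀ (Real.exp t)‖ₑ ∂σ ≤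
        ∫⁻ ω, W (Real.exp t • (ω : EuclideanSpace ℝ (Fin n))) ∂σ := by
      refine lintegral_mono_ae ?_
      filter_upwards [ht] with ω hω
      have : ‖Real.exp t • (ω : EuclideanSpace ℝ (Fin n))‖ = Real.exp t := by
        rw [norm_smul, Real.norm_of_nonneg (Real.exp_pos t).le]
        simp
      rwa [this] at hω
    rw [lintegral_const] at h3
    calc ‖u₀ (Real.exp t)‖ₑ = (σ Set.univ)⁻¹ * (‖u₀ (Real.exp t)‖ₑ * σ Set.univ) := by
          rw [mul_left_comm, ENNReal.inv_mul_cancel hσ0 (measure_ne_top _ _), mul_one]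
      _ ≤ _ := mul_le_mul' le_rfl h3
  have h0 : ∀ᵐ x : EuclideanSpace ℝ (Fin n), x ≠ 0 := by simp [ae_iff]
  filter_upwards [hu₀, ae_of_ae_log_norm hn h2, h0] with x hx1 hx2 hx0
  have hx : Real.exp (Real.log ‖x‖) = ‖x‖ := Real.exp_log (norm_pos_iff.2 hx0)
  rw [hx] at hx2 ⊢
  rwa [hx1]

theorem enorm_besselPotentialOp_le {𝕜 : Type*} [RCLike 𝕜] {n : ℕ} {s C : ℝ}
    (hC : ∀ x : EuclideanSpace ℝ (Fin n),
      ‖besselKernel n s x‖ₑ ≤ ENNReal.ofReal C * ‖x‖ₑ ^ (s - n))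
    {f : EuclideanSpace ℝ (Fin n) → 𝕜} {G : EuclideanSpace ℝ (Fin n) → ℝ≥0∞}
    (hG : (fun y => ‖f y‖ₑ) =ᵐ[volume] G) (x : EuclideanSpace ℝ (Fin n)) :
    ‖besselPotentialOp n s f x‖ₑ ≤ ENNReal.ofReal C * ∫⁻ y, ‖x - y‖ₑ ^ (s - n) * G y := by
  rw [← lintegral_const_mul' _ _ ENNReal.ofReal_ne_top]
  refine (enorm_integral_le_lintegral_enorm _).trans (lintegral_mono_ae ?_)
  filter_upwards [hG] with y hy
  rw [enorm_mul, ← hy, ← mul_assoc]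
  refine mul_le_mul' ?_ le_rfl
  have : ‖((besselKernel n s (x - y) : ℝ) : 𝕜)‖ₑ = ‖besselKernel n s (x - y)‖ₑ := by
    rw [← ofReal_norm, ← ofReal_norm, RCLike.norm_ofReal, Real.norm_eq_abs]
  rw [this]
  exact hC _

theorem mainTheorem6 {𝕜 : Type*} [RCLike 𝕜] (n : ℕ) (p s c : ℝ)
    (hp : 1 < p) (hs : 0 < s) (hsn : s < n / p)
    (hc : -(n : ℝ) < c) (hcs : (1 - s * p) * c ≤ ((n : ℝ) - 1) * p * s)
    (hpc : p ≤ criticalExponent n s p c) :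
    ∃ C : ℝ, 0 < C ∧ ∀ u : EuclideanSpace ℝ (Fin n) → 𝕜,
      MemPotentialSpace n s p u → IsRadial u →
        eLpNorm (fun x => ((‖x‖ ^ (c / criticalExponent n s p c) : ℝ) : 𝕜) * u x)
            (ENNReal.ofReal (criticalExponent n s p c)) volume
          ≤ ENNReal.ofReal C * potentialNorm n s p u := by
  have hp0 : 0 < p := by linarith
  have hn : n ≠ 0 := by
    rintro rfl
    simp at hsn
    linarith
  have : NeZero n := ⟨hn⟩
  have hn0 : (0 : ℝ) < n := by exact_mod_cast Nat.pos_of_ne_zero hn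
  have hsp : 0 < n - s * p := by
    rw [lt_div_iff₀ hp0] at hsn; linarith
  have hnc : 0 < n + c := by linarith
  have hsn' : s < n := hsn.trans (div_lt_self hn0 hp)
  set q := criticalExponent n s p c with hq
  have hqdef : q = p * (n + c) / (n - s * p) := rfl
  have hq0 : 0 < q := hp0.trans_le hpc
  set α : ℝ := n / p - s with hα
  have hα0 : 0 < α := sub_pos.2 hsn
  have hαq : α * q = n + c := by
    have : (n : ℝ) / p - s = (n - s * p) / p := by field_simp
    rw [hα, hqdef, this, div_mul_div_comm, mul_left_comm, mul_div_mul_left _ _ hp0.ne',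
      mul_div_cancel_left₀ _ hsp.ne']
  -- After clearing denominators this is `hcs`.
  have hpqs : 1 / p - s ≤ 1 / q := by
    have e1 : 1 / q = (n - s * p) / (p * (n + c)) := by rw [hqdef, one_div_div]
    have e2 : 1 / p - s = (1 - s * p) * (n + c) / (p * (n + c)) := by field_simp
    rw [e1, e2]
    gcongr
    nlinarith
  have hε : 0 < min α (n - n / p) / 2 := by
    have : 0 < (n : ℝ) - n / p := by have := div_lt_self hn0 hp; linarith
    have := lt_min hα0 this
    positivity
  obtain ⟨θ, hθ0, hθ1, hsθ, C₁, hC₁, hconv⟩ := exists_expRieszKernel_Lp_Lq hp hpc hs hpqs hε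
  obtain ⟨K, hK, hsph⟩ := lintegral_sphere_rieszPotential_le (s := s) hp hα0 hα hn hθ0 hθ1 hsθ
  obtain ⟨B, hB, hbes⟩ := enorm_besselKernel_le hs hsn'
  set σ := (volume : Measure (EuclideanSpace ℝ (Fin n))).toSphere with hσ
  have hσ0 : σ Set.univ ≠ 0 := by
    rw [Ne, Measure.measure_univ_eq_zero]
    exact Measure.toSphere_ne_zero _
  set D : ℝ≥0∞ := σ Set.univ ^ (1 / q) * ((σ Set.univ)⁻¹ * ENNReal.ofReal B * ENNReal.ofReal K *
    ENNReal.ofReal C₁) with hD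
  have hDtop : D ≠ ⊤ := by
    refine ENNReal.mul_ne_top (ENNReal.rpow_ne_top_of_nonneg (by positivity)
      (measure_ne_top _ _)) (ENNReal.mul_ne_top (ENNReal.mul_ne_top (ENNReal.mul_ne_top
      (ENNReal.inv_ne_top.2 hσ0) ENNReal.ofReal_ne_top) ENNReal.ofReal_ne_top)
      ENNReal.ofReal_ne_top)
  refine ⟨D.toReal + 1, by positivity, fun u _ hrad => ?_⟩
  have hDle : D ≤ ENNReal.ofReal (D.toReal + 1) := by
    rw [ENNReal.le_ofReal_iff_toReal_le hDtop (by positivity)]; linarith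
  have hC0 : ENNReal.ofReal (D.toReal + 1) ≠ 0 := by
    rw [Ne, ENNReal.ofReal_eq_zero, not_le]; positivity
  unfold potentialNorm
  -- The bound is proved for each representing `f`, so uniqueness of `f` plays no role.
  rw [ENNReal.mul_iInf_of_ne hC0 ENNReal.ofReal_ne_top]
  refine le_iInf fun f => ?_
  rw [ENNReal.mul_iInf_of_ne hC0 ENNReal.ofReal_ne_top]
  refine le_iInf fun hf => ?_
  obtain ⟨hfL, huf⟩ := hf
  have hfm : AEMeasurable (fun y => ‖f y‖ₑ) := hfL.1.enorm
  set G := hfm.mk _ with hG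
  have hGm : Measurable G := hfm.measurable_mk
  have hGae : (fun y => ‖f y‖ₑ) =ᵐ[volume] G := hfm.ae_eq_mk
  set I : EuclideanSpace ℝ (Fin n) → ℝ≥0∞ := fun x => ∫⁻ y, ‖x - y‖ₑ ^ (s - n) * G y with hI
  have hIm : Measurable I := measurable_lintegral_riesz (s - n) hGm
  have hIσ : ∀ t : ℝ, Measurable fun ω : Metric.sphere (0 : EuclideanSpace ℝ (Fin n)) 1 =>
    I (Real.exp t • (ω : EuclideanSpace ℝ (Fin n))) := fun t => hIm.comp (by fun_prop)
  have hW : ∀ᵐ x, ‖u x‖ₑ ≤ ENNReal.ofReal B * I x := by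
    filter_upwards [huf] with x hx
    rw [hx]
    exact enorm_besselPotentialOp_le hbes hGae x
  set V : ℝ → ℝ≥0∞ := fun t => (σ Set.univ)⁻¹ *
    ∫⁻ ω, ENNReal.ofReal B * I (Real.exp t • (ω : EuclideanSpace ℝ (Fin n))) ∂σ with hV
  have hVm : Measurable V := by
    refine Measurable.const_mul ?_ _
    apply Measurable.lintegral_prod_right' (f := fun z : ℝ ×
      Metric.sphere (0 : EuclideanSpace ℝ (Fin n)) 1 =>
      ENNReal.ofReal B * I (Real.exp z.1 • (z.2 : EuclideanSpace ℝ (Fin n))))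
    fun_prop
  have hbound : ∀ᵐ x : EuclideanSpace ℝ (Fin n), ‖u x‖ₑ ≤ V (Real.log ‖x‖) :=
    hrad.ae_enorm_le_sphere_average hn hW
  set Φ : ℝ → ℝ≥0∞ := fun τ => ENNReal.ofReal (Real.exp (n / p * τ)) *
    (∫⁻ ω, G (Real.exp τ • (ω : EuclideanSpace ℝ (Fin n))) ^ p ∂σ) ^ (1 / p) with hΦ
  have hΦm : Measurable Φ := by
    refine Measurable.mul (by fun_prop) (Measurable.pow_const ?_ _)
    apply Measurable.lintegral_prod_right' (f := fun z : ℝ ×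
      Metric.sphere (0 : EuclideanSpace ℝ (Fin n)) 1 =>
      G (Real.exp z.1 • (z.2 : EuclideanSpace ℝ (Fin n))) ^ p)
    fun_prop
  set κ := expRieszKernel (min α (n - n / p) / 2) θ with hκ
  set M : ℝ≥0∞ := (σ Set.univ)⁻¹ * ENNReal.ofReal B * ENNReal.ofReal K with hM
  have hMtop : M ≠ ⊤ := ENNReal.mul_ne_top (ENNReal.mul_ne_top
      (ENNReal.inv_ne_top.2 hσ0) ENNReal.ofReal_ne_top) ENNReal.ofReal_ne_top
  have hVle : ∀ t, ENNReal.ofReal (Real.exp (α * t)) * V t ≤ M * ∫⁻ τ, κ (t - τ) * Φ τ := by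
    intro t
    calc _ = (σ Set.univ)⁻¹ * ENNReal.ofReal B * (ENNReal.ofReal (Real.exp (α * t)) *
          ∫⁻ ω, I (Real.exp t • (ω : EuclideanSpace ℝ (Fin n))) ∂σ) := by
          rw [hV]
          simp only
          rw [lintegral_const_mul _ (hIσ t)]
          ring
      _ ≤ (σ Set.univ)⁻¹ * ENNReal.ofReal B * (ENNReal.ofReal K * ∫⁻ τ, κ (t - τ) * Φ τ) :=
          mul_le_mul' le_rfl (hsph G hGm t)
      _ = _ := by rw [hM]; ring
  have hfnorm : eLpNorm f (ENNReal.ofReal p) volume = (∫⁻ τ, Φ τ ^ p) ^ (1 / p) := by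
    rw [eLpNorm_eq_lintegral_rpow_enorm_toReal (by simpa using hp0) ENNReal.ofReal_ne_top,
      ENNReal.toReal_ofReal hp0.le, hΦ, lintegral_rpow_eq_log_polar hn hp0 hGm]
    congr 1
    refine lintegral_congr_ae ?_
    filter_upwards [hGae] with x hx
    rw [hx]
  rw [hfnorm, eLpNorm_eq_lintegral_rpow_enorm_toReal (by simpa using hq0) ENNReal.ofReal_ne_top,
    ENNReal.toReal_ofReal hq0.le]
  calc _ ≤ (∫⁻ x : EuclideanSpace ℝ (Fin n),
        (ENNReal.ofReal (‖x‖ ^ (c / q)) * V (Real.log ‖x‖)) ^ q) ^ (1 / q) := by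
        refine ENNReal.rpow_le_rpow (lintegral_mono_ae ?_) (by positivity)
        filter_upwards [hbound] with x hx
        refine ENNReal.rpow_le_rpow ?_ hq0.le
        rw [enorm_mul]
        refine mul_le_mul' (le_of_eq ?_) hx
        rw [← ofReal_norm, RCLike.norm_ofReal, abs_of_nonneg (by positivity)]
    _ = σ Set.univ ^ (1 / q) * (∫⁻ t, (ENNReal.ofReal (Real.exp (α * t)) * V t) ^ q) ^ (1 / q) := by
        rw [lintegral_weight_log_norm_eq hn hq0 hαq hVm,
          ENNReal.mul_rpow_of_nonneg _ _ (by positivity)]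
    _ ≤ σ Set.univ ^ (1 / q) * (∫⁻ t, (M * ∫⁻ τ, κ (t - τ) * Φ τ) ^ q) ^ (1 / q) := by
        exact mul_le_mul' le_rfl (ENNReal.rpow_le_rpow (lintegral_mono fun t =>
          ENNReal.rpow_le_rpow (hVle t) hq0.le) (by positivity))
    _ = σ Set.univ ^ (1 / q) * (M * (∫⁻ t, (∫⁻ τ, κ (t - τ) * Φ τ) ^ q) ^ (1 / q)) := by
        simp_rw [ENNReal.mul_rpow_of_nonneg _ _ hq0.le]
        rw [lintegral_const_mul' _ _ (ENNReal.rpow_ne_top_of_nonneg hq0.le hMtop),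
          ENNReal.mul_rpow_of_nonneg _ _ (by positivity), ← ENNReal.rpow_mul,
          mul_one_div_cancel hq0.ne', ENNReal.rpow_one]
    _ ≤ σ Set.univ ^ (1 / q) * (M * (ENNReal.ofReal C₁ * (∫⁻ τ, Φ τ ^ p) ^ (1 / p))) := by
        gcongr
        exact hconv Φ hΦm
    _ = D * (∫⁻ τ, Φ τ ^ p) ^ (1 / p) := by rw [hD, hM]; ring
    _ ≤ _ := by gcongr
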